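/- Let $n\ge 2$ be an integer, let $\theta\in\mathbb R$, and let $H(\theta)=\{re^{i(\theta+\phi)} : r>0,\ -\pi/2<\phi<\pi/2\}$. Let $\omega_1,\dots,\omega_n\in H(\theta)$ satisfy $\operatorname{Im}(\omega_j/\omega_k)\ne 0$ whenever $j\neq k$, let $0\le y<1$, and put $a(y)=\sum_{j=1}^n\omega_j(1-y)\in H(\theta)$. Powers $x^{-s}$ of $x\in H(\theta)$ are taken with $\arg x\in(\theta-\pi/2,\theta+\pi/2)$. Then the Barnes zeta function $$\zeta_n(s,a(y);\omega_1,\dots,\omega_n)=\sum_{m_1,\dots,m_n\ge 0}\frac{1}{(a(y)+\omega_1m_1+\cdots+\omega_nm_n)^{s}},$$ whose series converges absolutely for $\operatorname{Re}s>n$, has a (unique) meromorphic continuation to $\mathbb C$, denoted by the same symbol, and the following holds. Let $l\in\mathbb Z$, with $l>n$ if $y=0$. For each $k$ the series over $m$ below converges absolutely, and $$\sum_{k=1}^n\sum_{m\in\mathbb Z\setminus\{0\}}\omega_k^{-1}\Bigl(\prod_{\substack{1\le j\le n\\ j\ne k}}\frac{e^{(2m\pi i\omega_j/\omega_k)y}}{e^{2m\pi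 i\omega_j/\omega_k}-1}\Bigr)(2m\pi i\,\omega_k^{-1})^{n-l-1}e^{2m\pi i y}$$ $$=\begin{cases}\dfrac{(-1)^{l-n+1}}{(l-n)!}\,\zeta_n(n-l,a(y);\omega_1,\dots,\omega_n)&(l\ge n),\\[2mm]-(n-l-1)!\,\operatorname{Res}_{s=n-l}\zeta_n(s,a(y);\omega_1,\dots,\omega_n)&(l<n),\end{cases}$$ where in the case $l\ge n$ the function $\zeta_n(s,a(y);\omega_1,\dots,\omega_n)$ is holomorphic at $s=n-l$. Moreover this quantity equals $$-\sum_{\substack{m_1,\dots,m_n\ge0\\ m_1+\cdots+m_n=l}}\ \prod_{j=1}^n\frac{B_{m_j}(y)}{m_j!}\,\omega_j^{m_j-1},$$ where the empty sum is $0$ and the Bernoulli polynomials $B_j(y)$ are defined by $\dfrac{te^{ty}}{e^t-1}=\sum_{j\ge0}B_j(y)\dfrac{t^j}{j!}$. -/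

import Mathlib

open Complex Filter Topology

/-- `H(θ)`, the open half plane of all `r * exp (i (θ + φ))` with `r > 0` and `-π/2 < φ < π/2`,
that is, the open half plane with boundary through `0` and normal vector `exp (i θ)`. -/
def halfPlane (θ : ℝ) : Set ℂ := {z | 0 < (z * exp (-(θ * I))).re}

/-- The power `x ^ s` for `x ∈ H(θ)`, with the branch of `arg x` in `(θ - π/2, θ + π/2)`: since
`x * exp (-iθ)` has positive real part, `log (x * exp (-iθ)) + iθ` is the logarithm of `x` whose
imaginary part lies in that interval. -/
noncomputable def halfPlanePow (θ : ℝ) (x s : ℂ) : ℂ :=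
  exp (s * (log (x * exp (-(θ * I))) + θ * I))

/-- `Z` is the Barnes zeta function `s ↦ ζ_n(s, a; ω_1, …, ω_n)` for `a, ω_1, …, ω_n ∈ H(θ)`:
it is meromorphic on the whole plane, and for `Re s > n` it is the (absolutely convergent) sum of
the multiple Dirichlet series `∑ (a + ω_1 m_1 + ⋯ + ω_n m_n) ^ (-s)` over `m_1, …, m_n ≥ 0`.
"Normal form" means that the value of `Z` at each point where it has no pole is the value of the
analytic function it represents there (and the value at a pole is set to `0`). -/
def IsBarnesZeta {n : ℕ} (θ : ℝ) (a : ℂ) (ω : Fin n → ℂ) (Z : ℂ → ℂ) : Prop :=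
  MeromorphicNFOn Z Set.univ ∧
    ∀ s : ℂ, (n : ℝ) < s.re →
      HasSum (fun m : Fin n → ℕ => halfPlanePow θ (a + ∑ j, ω j * (m j : ℂ)) (-s)) (Z s)

/-- There is at most one such function. -/
theorem IsBarnesZeta.unique {n : ℕ} {θ : ℝ} {a : ℂ} {ω : Fin n → ℂ} {Z W : ℂ → ℂ}
    (hZ : IsBarnesZeta θ a ω Z) (hW : IsBarnesZeta θ a ω W) : Z = W := by
  have hm : MeromorphicOn (Z - W) Set.univ := hZ.1.meromorphicOn.sub hW.1.meromorphicOn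
  have hopen : {s : ℂ | (n : ℝ) < s.re} ∈ 𝓝 ((n : ℂ) + 1) :=
    (isOpen_lt continuous_const continuous_re).mem_nhds (by simp)
  have h0 : meromorphicOrderAt (Z - W) ((n : ℂ) + 1) = ⊤ := by
    rw [meromorphicOrderAt_eq_top_iff]
    filter_upwards [mem_nhdsWithin_of_mem_nhds hopen] with s hs
    simp [(hZ.2 s hs).unique (hW.2 s hs)]
  funext z
  have hz : meromorphicOrderAt (Z - W) z = ⊤ := by
    by_contra h
    exact hm.meromorphicOrderAt_ne_top_of_isPreconnected isPreconnected_univ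
      (Set.mem_univ z) (Set.mem_univ _) h h0
  rw [meromorphicOrderAt_eq_top_iff] at hz
  have he : Z =ᶠ[𝓝[≠] z] W := by
    filter_upwards [hz] with s hs
    exact sub_eq_zero.mp hs
  exact (((hZ.1 (Set.mem_univ z)).eventuallyEq_nhdsNE_iff_eventuallyEq_nhds
    (hW.1 (Set.mem_univ z))).1 he).eq_of_nhds

/-- The Barnes zeta function `s ↦ ζ_n(s, a; ω_1, …, ω_n)` on the whole plane: the unique function
satisfying `IsBarnesZeta θ a ω`, if there is one. -/
noncomputable def barnesZeta {n : ℕ} (θ : ℝ) (a : ℂ) (ω : Fin n → ℂ) : ℂ → ℂ :=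
  Classical.epsilon (IsBarnesZeta θ a ω)

/-- `a(y) = ω_1 (1 - y) + ⋯ + ω_n (1 - y)`. -/
noncomputable def barnesShift {n : ℕ} (ω : Fin n → ℂ) (y : ℝ) : ℂ :=
  ∑ j, ω j * (1 - y)

/-- The residue at `c` of a function `f` meromorphic at `c`: the common value, for all small
`r > 0`, of `(2 π i)⁻¹` times the integral of `f` over the positively oriented circle of
radius `r` around `c`. -/
noncomputable def residueAt (f : ℂ → ℂ) (c : ℂ) : ℂ :=
  limUnder (𝓝[>] (0 : ℝ)) fun r => (2 * Real.pi * I)⁻¹ * ∮ z in C(c, r), f z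

/-- The `(k, m)`-term
`ω_k⁻¹ (∏_{j ≠ k} e^{(2mπi ω_j/ω_k) y} / (e^{2mπi ω_j/ω_k} - 1)) (2mπi ω_k⁻¹)^(n-l-1) e^{2mπi y}`
of the series. -/
noncomputable def barnesTerm {n : ℕ} (ω : Fin n → ℂ) (y : ℝ) (l : ℤ) (k : Fin n) (m : ℤ) : ℂ :=
  (ω k)⁻¹ *
    (∏ j ∈ Finset.univ.erase k,
      exp (2 * m * Real.pi * I * ω j / ω k * y) / (exp (2 * m * Real.pi * I * ω j / ω k) - 1)) *
    (2 * m * Real.pi * I * (ω k)⁻¹) ^ ((n : ℤ) - l - 1) * exp (2 * m * Real.pi * I * y)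

/-- The finite sum `∑ ∏_j B_{m_j}(y) / m_j! * ω_j ^ (m_j - 1)` over all `m_1, …, m_n ≥ 0` with
`m_1 + ⋯ + m_n = l`; it is empty, hence `0`, if `l < 0`. -/
noncomputable def bernoulliSum {n : ℕ} (ω : Fin n → ℂ) (y : ℝ) (l : ℤ) : ℂ :=
  if 0 ≤ l then
    ∑ m ∈ Finset.piAntidiag (Finset.univ : Finset (Fin n)) l.toNat,
      ∏ j, (bernoulliFun (m j) y : ℂ) / ((m j).factorial : ℂ) * ω j ^ ((m j : ℤ) - 1)
  else 0

/-!
Let `K(t) = ∏ⱼ e^{ω_j t y} / (e^{ω_j t} - 1)` (`barnesKernel`). The generating function of the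
Bernoulli polynomials gives its Laurent expansion `K(t) = ∑ c_l t^{l-n}` at the origin, where
`c_l = bernoulliSum ω y l` (`barnesKernel_sub_isBigO`). Both sides of the theorem are expressed
through the single coefficient `c_l`.

*The series.* The function `t^{n-l-1} K(t)` has residue `c_l` at `0`. Its other poles are the points
`2πim/ω_k`, `m ≠ 0`; they are simple, because no quotient `ω_j/ω_k` is real, and the residues are
the terms of the series (`tendsto_residue_barnesKernel`). Each factor of `K` is bounded away from
its poles and decays exponentially in `|Re ω_j t|` if `0 < y < 1`; as `n ≥ 2` and two of the `ω_j`
are independent over `ℝ`, the product then decays exponentially in `|t|`, while for `y = 0` the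
hypothesis `l > n` provides the decay `|t|^{-2}`. Integrating over circles that keep a fixed
distance from the poles (`exists_radii`), the residue theorem shows that all residues add up to `0`,
so the series equals `-c_l` (`sum_tsum_barnesTerm`).

*The zeta function.* After a rotation one may take `Re ω_j > 0`. Expanding `K` into exponentials
gives `Γ(s) ζ_n(s) = ∫₀^∞ t^{s-1} K(t) dt` for `Re s > n` (`hasSum_mellin_barnesKernel`), and the
expansion at `0` continues the integral to the plane with at most simple poles at the points `n - l`
and residues `c_l` there (`exists_mellin_continuation`). Dividing by `Γ` yields the residue
`c_l / (n-l-1)!` if `l < n`, whereas for `l ≥ n` the simple zero of `1/Γ` at `-(l-n)` cancels the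
pole and leaves the value `(-1)^{l-n} (l-n)! c_l` (`tendsto_Gamma_inv_div`).
-/

/-! ### Asymptotic power series at the origin -/

/-- `f` has the asymptotic expansion `∑ pᵢ zⁱ` as `z → 0`, `z ≠ 0`: each truncation of the formal
power series `p` below degree `N` approximates `f` up to `O(z ^ N)`. -/
def HasAsymptoticSeries (f : ℂ → ℂ) (p : PowerSeries ℂ) : Prop :=
  ∀ N : ℕ, (fun z => f z - (p.trunc N).eval z) =O[𝓝[≠] 0] fun z => z ^ N

theorem PowerSeries.eval_trunc (p : PowerSeries ℂ) (N : ℕ) (z : ℂ) :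
    (p.trunc N).eval z = ∑ i ∈ Finset.range N, p.coeff i * z ^ i :=
  PowerSeries.eval₂_trunc_eq_sum_range z (RingHom.id ℂ) N p

namespace HasAsymptoticSeries

variable {f g : ℂ → ℂ} {p q : PowerSeries ℂ}

theorem eval_isBigO_one (P : Polynomial ℂ) :
    (fun z => P.eval z) =O[𝓝[≠] (0 : ℂ)] fun _ => (1 : ℂ) :=
  (P.continuous.continuousAt.tendsto.mono_left nhdsWithin_le_nhds).isBigO_one ℂ

theorem eval_isBigO_pow {P : Polynomial ℂ} {N : ℕ} (h : Polynomial.X ^ N ∣ P) :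
    (fun z => P.eval z) =O[𝓝[≠] (0 : ℂ)] fun z => z ^ N := by
  obtain ⟨Q, rfl⟩ := h
  simpa using (Asymptotics.isBigO_refl (fun z : ℂ => z ^ N) (𝓝[≠] 0)).mul (eval_isBigO_one Q)

theorem isBigO_one (hf : HasAsymptoticSeries f p) : f =O[𝓝[≠] 0] fun _ => (1 : ℂ) := by
  simpa using hf 0

theorem congr (hf : HasAsymptoticSeries f p) (h : f =ᶠ[𝓝[≠] 0] g) : HasAsymptoticSeries g p := by
  intro N
  refine (hf N).congr' ?_ EventuallyEq.rfl
  filter_upwards [h] with z hz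
  rw [hz]

theorem polynomial (P : Polynomial ℂ) :
    HasAsymptoticSeries (fun z => P.eval z) (P : PowerSeries ℂ) := by
  intro N
  simp only [← Polynomial.eval_sub]
  refine eval_isBigO_pow (Polynomial.X_pow_dvd_iff.2 fun d hd => ?_)
  simp [PowerSeries.coeff_trunc, hd]

theorem sub_isBigO (hf : HasAsymptoticSeries f p) (hg : HasAsymptoticSeries g q) {N : ℕ}
    (h : p.trunc N = q.trunc N) : (fun z => f z - g z) =O[𝓝[≠] 0] fun z => z ^ N := by
  refine ((hf N).sub (hg N)).congr_left fun z => ?_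
  rw [h]
  ring

theorem mul (hf : HasAsymptoticSeries f p) (hg : HasAsymptoticSeries g q) :
    HasAsymptoticSeries (fun z => f z * g z) (p * q) := by
  intro N
  have h1 := (hf N).mul hg.isBigO_one
  have h2 := (eval_isBigO_one (p.trunc N)).mul (hg N)
  have h3 : (fun z => (p.trunc N * q.trunc N - (p * q).trunc N).eval z) =O[𝓝[≠] (0 : ℂ)]
      fun z => z ^ N := by
    refine eval_isBigO_pow (Polynomial.X_pow_dvd_iff.2 fun d hd => ?_)
    have : PowerSeries.coeff d ((p.trunc N * q.trunc N : Polynomial ℂ) : PowerSeries ℂ) =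
        PowerSeries.coeff d (p * q) := by
      rw [Polynomial.coe_mul]
      exact PowerSeries.coeff_mul_eq_coeff_trunc_mul_trunc p q hd |>.symm
    rw [Polynomial.coeff_sub, PowerSeries.coeff_trunc, if_pos hd, ← this, Polynomial.coeff_coe,
      sub_self]
  simp only [mul_one, one_mul] at h1 h2
  refine ((h1.add h2).add h3).congr_left fun z => ?_
  simp only [Polynomial.eval_sub, Polynomial.eval_mul]
  ring

theorem prod {ι : Type*} (s : Finset ι) {F : ι → ℂ → ℂ} {P : ι → PowerSeries ℂ}
    (h : ∀ i ∈ s, HasAsymptoticSeries (F i) (P i)) :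
    HasAsymptoticSeries (fun z => ∏ i ∈ s, F i z) (∏ i ∈ s, P i) := by
  classical
  induction s using Finset.induction_on with
  | empty => simpa using polynomial 1
  | insert a s ha ih =>
    simp only [Finset.prod_insert ha]
    exact (h a (Finset.mem_insert_self a s)).mul
      (ih fun i hi => h i (Finset.mem_insert_of_mem hi))

theorem comp_mul (hf : HasAsymptoticSeries f p) {a : ℂ} (ha : a ≠ 0) :
    HasAsymptoticSeries (fun z => f (a * z)) (PowerSeries.rescale a p) := by
  intro N
  have ht : Tendsto (fun z : ℂ => a * z) (𝓝[≠] 0) (𝓝[≠] 0) := by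
    refine tendsto_nhdsWithin_iff.2 ⟨?_, ?_⟩
    · have : Tendsto (fun z : ℂ => a * z) (𝓝 0) (𝓝 (a * 0)) :=
        (continuous_const_mul a).tendsto 0
      rw [mul_zero] at this
      exact this.mono_left nhdsWithin_le_nhds
    · filter_upwards [self_mem_nhdsWithin] with z hz
      exact mul_ne_zero ha hz
  have h := (hf N).comp_tendsto ht
  simp only [Function.comp_def, mul_pow] at h
  refine (h.trans (Asymptotics.isBigO_const_mul_self _ _ _)).congr_left fun z => ?_
  simp only [PowerSeries.eval_trunc, PowerSeries.coeff_rescale, mul_pow]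
  congr 1
  exact Finset.sum_congr rfl fun i _ => by ring

/-- An asymptotic expansion of a quotient `g = h / D`, with `D` bounded away from zero, is obtained
by dividing formally. -/
theorem of_mul {D h : ℂ → ℂ} {d b : PowerSeries ℂ} (hD : HasAsymptoticSeries D d)
    (hh : HasAsymptoticSeries h (d * b)) (hi : (fun z => (D z)⁻¹) =O[𝓝[≠] 0] fun _ => (1 : ℂ))
    (hne : ∀ᶠ z in 𝓝[≠] 0, D z ≠ 0) : HasAsymptoticSeries (fun z => h z / D z) b := by
  intro N
  have h1 := hh.sub_isBigO (hD.mul (polynomial (b.trunc N))) (N := N) (by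
    ext k
    simp only [PowerSeries.coeff_trunc]
    split_ifs with hk
    · rw [PowerSeries.coeff_mul_eq_coeff_trunc_mul_trunc d b hk,
        PowerSeries.coeff_mul_eq_coeff_trunc_mul_trunc d _ hk, PowerSeries.trunc_trunc]
    · rfl)
  refine (hi.mul h1).congr' ?_ (by simp)
  filter_upwards [hne] with z hz
  field_simp

end HasAsymptoticSeries

theorem hasAsymptoticSeries_exp (a : ℂ) :
    HasAsymptoticSeries (fun z => exp (z * a)) (PowerSeries.rescale a (PowerSeries.exp ℂ)) := by
  intro N
  have ht : Tendsto (fun z : ℂ => z * a) (𝓝[≠] 0) (𝓝 0) := by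
    have : Tendsto (fun z : ℂ => z * a) (𝓝 0) (𝓝 (0 * a)) := (continuous_mul_const a).tendsto 0
    rw [zero_mul] at this
    exact this.mono_left nhdsWithin_le_nhds
  have h := (Complex.exp_sub_sum_range_isBigO_pow N).comp_tendsto ht
  simp only [Function.comp_def, mul_pow _ a] at h
  refine (h.trans ?_).congr_left fun z => ?_
  · simpa only [mul_comm] using Asymptotics.isBigO_const_mul_self (a ^ N) (fun z : ℂ => z ^ N) _
  · simp only [PowerSeries.eval_trunc, PowerSeries.coeff_rescale, PowerSeries.coeff_exp]
    congr 1
    refine Finset.sum_congr rfl fun i _ => ?_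
    simp
    ring

/-! ### The Bernoulli kernel and its expansion at the origin -/

/-- The generating function `e^{yz} / (e^z - 1)` of the Bernoulli polynomials, divided by `z`. -/
noncomputable def bernoulliKernel (y : ℝ) (z : ℂ) : ℂ := exp (z * y) / (exp z - 1)

/-- The product `∏ⱼ e^{ω_j t y} / (e^{ω_j t} - 1)`, whose Laurent expansion at `0`, Mellin transform
and residues give the three expressions to be compared. -/
noncomputable def barnesKernel {n : ℕ} (ω : Fin n → ℂ) (y : ℝ) (t : ℂ) : ℂ :=
  ∏ j, bernoulliKernel y (ω j * t)

/-- The formal power series `∑ Bᵢ(y) zⁱ / i!`. -/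
noncomputable def bernoulliSeries (y : ℝ) : PowerSeries ℂ :=
  PowerSeries.mk fun i => (bernoulliFun i y : ℂ) / (i.factorial : ℂ)

theorem bernoulliSeries_mul (y : ℝ) :
    bernoulliSeries y * (PowerSeries.exp ℂ - 1) =
      PowerSeries.X * PowerSeries.rescale (y : ℂ) (PowerSeries.exp ℂ) := by
  rw [← Polynomial.bernoulli_generating_function (y : ℂ)]
  congr 1
  ext i
  simp only [bernoulliSeries, PowerSeries.coeff_mk, bernoulliFun, map_smul]
  rw [Polynomial.eval_map_algebraMap, ← Complex.coe_algebraMap, ← Polynomial.aeval_algebraMap_apply,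
    Algebra.smul_def]
  simp [div_eq_inv_mul]

theorem tendsto_exp_sub_one_div :
    Tendsto (fun z : ℂ => (exp z - 1) / z) (𝓝[≠] 0) (𝓝 1) := by
  have := (Complex.hasDerivAt_exp 0).tendsto_slope_zero
  simpa [div_eq_inv_mul] using this

theorem hasAsymptoticSeries_bernoulliKernel (y : ℝ) :
    HasAsymptoticSeries (fun z => z * bernoulliKernel y z) (bernoulliSeries y) := by
  -- `z * bernoulliKernel y z = e^{yz} / D(z)`, where `D(z) = (e^z - 1) / z` has the formal series `d`
  obtain ⟨d, hd⟩ : (PowerSeries.X : PowerSeries ℂ) ∣ PowerSeries.exp ℂ - 1 :=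
    PowerSeries.X_dvd_iff.2 (by simp)
  have hD : HasAsymptoticSeries (fun z => (exp z - 1) / z) d := by
    intro N
    have h1 : HasAsymptoticSeries (fun z => exp z) (PowerSeries.exp ℂ) := by
      simpa using hasAsymptoticSeries_exp 1
    have h2 := (h1 (N + 1)).mul (Asymptotics.isBigO_refl (fun z : ℂ => z⁻¹) (𝓝[≠] 0))
    refine h2.congr' ?_ ?_
    · filter_upwards [self_mem_nhdsWithin] with z hz
      have hz : z ≠ 0 := hz
      have he : PowerSeries.exp ℂ = PowerSeries.X * d + 1 := by rw [← hd]; ring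
      rw [he]
      simp only [PowerSeries.eval_trunc]
      rw [Finset.sum_range_succ']
      simp only [map_add, PowerSeries.coeff_succ_X_mul]
      simp only [PowerSeries.coeff_one, Nat.add_eq_zero_iff, one_ne_zero, and_false, if_false,
        add_zero, pow_succ, ← mul_assoc, ← Finset.sum_mul]
      simp
      field_simp
      ring
    · filter_upwards [self_mem_nhdsWithin] with z hz
      have hz : z ≠ 0 := hz
      rw [pow_succ, mul_inv_cancel_right₀ hz]
  have hne : ∀ᶠ z in 𝓝[≠] (0 : ℂ), (exp z - 1) / z ≠ 0 :=
    tendsto_exp_sub_one_div.eventually_ne one_ne_zero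
  have hi : (fun z : ℂ => ((exp z - 1) / z)⁻¹) =O[𝓝[≠] 0] fun _ => (1 : ℂ) :=
    (tendsto_exp_sub_one_div.inv₀ one_ne_zero).isBigO_one ℂ
  have hb : d * bernoulliSeries y = PowerSeries.rescale (y : ℂ) (PowerSeries.exp ℂ) := by
    have := bernoulliSeries_mul y
    rw [hd] at this
    refine mul_left_cancel₀ PowerSeries.X_ne_zero ?_
    rw [← this]
    ring
  refine (hD.of_mul (hb ▸ hasAsymptoticSeries_exp (y : ℂ)) hi hne).congr ?_
  filter_upwards [self_mem_nhdsWithin] with z hz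
  rw [bernoulliKernel, div_div_eq_mul_div]
  ring

theorem bernoulliSum_natCast {n : ℕ} {ω : Fin n → ℂ} (hω : ∀ j, ω j ≠ 0) (y : ℝ) (i : ℕ) :
    bernoulliSum ω y i = PowerSeries.coeff i
      (∏ j, PowerSeries.C (ω j)⁻¹ * PowerSeries.rescale (ω j) (bernoulliSeries y)) := by
  rw [bernoulliSum, if_pos (Int.natCast_nonneg i), Int.toNat_natCast, PowerSeries.coeff_prod]
  refine Finset.sum_bij' (fun m _ => Finsupp.equivFunOnFinite.symm m)
    (fun m _ => Finsupp.equivFunOnFinite m) ?_ ?_ ?_ ?_ ?_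
  · intro m hm
    simpa [Finset.mem_finsuppAntidiag] using hm
  · intro m hm
    simpa [Finset.mem_finsuppAntidiag] using hm
  · intro m _
    simp
  · intro m _
    simp
  · intro m _
    refine Finset.prod_congr rfl fun j _ => ?_
    rw [PowerSeries.coeff_C_mul, PowerSeries.coeff_rescale, zpow_sub_one₀ (hω j), zpow_natCast]
    simp [bernoulliSeries]
    ring

/-- The Laurent expansion of the kernel at the origin. -/
theorem barnesKernel_sub_isBigO {n : ℕ} {ω : Fin n → ℂ} (hω : ∀ j, ω j ≠ 0) (y : ℝ) (N : ℕ) :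
    (fun t => t ^ n * barnesKernel ω y t - ∑ i ∈ Finset.range N, bernoulliSum ω y i * t ^ i)
      =O[𝓝[≠] 0] fun t => t ^ N := by
  have h := HasAsymptoticSeries.prod Finset.univ fun j _ =>
    (HasAsymptoticSeries.polynomial (Polynomial.C (ω j)⁻¹)).mul
      ((hasAsymptoticSeries_bernoulliKernel y).comp_mul (hω j))
  refine (h N).congr_left fun t => ?_
  congr 1
  · simp only [Polynomial.eval_C, barnesKernel]
    have : t ^ n = ∏ _j : Fin n, t := by simp
    rw [this, ← Finset.prod_mul_distrib]
    refine Finset.prod_congr rfl fun j _ => ?_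
    have := hω j
    field_simp
  · simp only [PowerSeries.eval_trunc, Polynomial.coe_C]
    exact Finset.sum_congr rfl fun i _ => by rw [bernoulliSum_natCast hω]

/-! ### Bounds for the kernel away from its poles -/

/-- Away from the lattice `2πiℤ` of its zeros, `e^z - 1` is at least a constant times
`max 1 |e^z|`. On the strip `|Re z| ≤ 1` this is periodicity and compactness. -/
theorem exists_le_norm_exp_sub_one {δ : ℝ} (hδ : 0 < δ) :
    ∃ κ > 0, ∀ z : ℂ, (∀ m : ℤ, δ ≤ ‖z - m * (2 * Real.pi * I)‖) →
      κ ≤ ‖exp z - 1‖ ∧ κ * Real.exp z.re ≤ ‖exp z - 1‖ := by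
  let K : Set ℂ := (Set.Icc (-1) 1 ×ℂ Set.Icc (-Real.pi) Real.pi) ∩ {z | δ ≤ ‖z‖}
  have hK : IsCompact K := (isCompact_Icc.reProdIm isCompact_Icc).inter_right
    (isClosed_le continuous_const continuous_norm)
  obtain ⟨μ, hμ0, hμ⟩ := hK.exists_forall_le' (f := fun z => ‖exp z - 1‖) (a := 0)
    (by fun_prop) (by
      rintro z ⟨⟨hz1, hz2⟩, hz⟩
      rw [norm_pos_iff, sub_ne_zero]
      intro h
      obtain ⟨m, rfl⟩ := Complex.exp_eq_one_iff.1 h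
      have him : ((m : ℂ) * (2 * Real.pi * I)).im = m * (2 * Real.pi) := by simp
      simp only [Set.mem_preimage, him, Set.mem_Icc] at hz2
      have hm : m = 0 := by
        have h1 : (m : ℝ) < 1 := by nlinarith [Real.pi_pos]
        have h2 : (-1 : ℝ) < m := by nlinarith [Real.pi_pos]
        have h1 : m < 1 := by exact_mod_cast h1
        have h2 : -1 < m := by exact_mod_cast h2
        omega
      subst hm
      simp only [Int.cast_zero, zero_mul, Set.mem_ofPred_eq, norm_zero] at hz
      linarith)
  refine ⟨min (1 / 2) (μ / 3), by positivity, fun z hz => ?_⟩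
  have hk1 : min (1 / 2) (μ / 3) ≤ 1 / 2 := min_le_left _ _
  have hk2 : min (1 / 2) (μ / 3) ≤ μ / 3 := min_le_right _ _
  have hn1 : Real.exp z.re - 1 ≤ ‖exp z - 1‖ := by
    have := norm_sub_norm_le (exp z) 1
    rwa [Complex.norm_exp, norm_one] at this
  have hn2 : 1 - Real.exp z.re ≤ ‖exp z - 1‖ := by
    have := norm_sub_norm_le 1 (exp z)
    rwa [Complex.norm_exp, norm_one, norm_sub_rev] at this
  have he := Real.exp_pos z.re
  rcases lt_or_ge 1 z.re with h1 | h1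
  · have : 2 ≤ Real.exp z.re := by linarith [Real.add_one_le_exp z.re]
    constructor <;> nlinarith
  rcases lt_or_ge z.re (-1) with h2 | h2
  · have h3 : Real.exp z.re * 2 ≤ 1 := by
      have h4 : 2 ≤ Real.exp (-z.re) := by linarith [Real.add_one_le_exp (-z.re)]
      have h5 : Real.exp z.re * Real.exp (-z.re) = 1 := by rw [← Real.exp_add]; simp
      nlinarith
    constructor <;> nlinarith
  · have h3 : Real.exp z.re ≤ 3 := by
      have := Real.exp_one_lt_d9
      have := Real.exp_le_exp.2 h1
      linarith
    set m := round (z.im / (2 * Real.pi)) with hm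
    have hm' := abs_sub_round (z.im / (2 * Real.pi))
    have hw : z - m * (2 * Real.pi * I) ∈ K := by
      refine ⟨⟨?_, ?_⟩, hz m⟩
      · simp only [Set.mem_preimage, Set.mem_Icc]
        simp [h1, h2]
      · have him : (z - m * (2 * Real.pi * I)).im = z.im - m * (2 * Real.pi) := by simp
        simp only [Set.mem_preimage, Set.mem_Icc, him]
        rw [← hm, abs_le] at hm'
        have hpi := Real.pi_pos
        have hdiv : z.im = z.im / (2 * Real.pi) * (2 * Real.pi) := by field_simp
        constructor <;> nlinarith
    have h4 := hμ _ hw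
    have hper : exp (z - m * (2 * Real.pi * I)) = exp z := Complex.exp_periodic.sub_int_mul_eq m
    simp only [hper] at h4
    constructor <;> nlinarith

/-- Away from its poles a single factor decays like `e^{-(1-y) Re z}` to the right and like
`e^{-y |Re z|}` to the left. -/
theorem exists_norm_bernoulliKernel_le {y : ℝ} {δ : ℝ} (hδ : 0 < δ) :
    ∃ C > 0, ∀ z : ℂ, (∀ m : ℤ, δ ≤ ‖z - m * (2 * Real.pi * I)‖) →
      ‖bernoulliKernel y z‖ ≤ C * Real.exp (-(min y (1 - y) * |z.re|)) := by
  obtain ⟨κ, hκ, h⟩ := exists_le_norm_exp_sub_one hδ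
  refine ⟨κ⁻¹, by positivity, fun z hz => ?_⟩
  obtain ⟨h1, h2⟩ := h z hz
  have hn : ‖bernoulliKernel y z‖ = Real.exp (z.re * y) / ‖exp z - 1‖ := by
    rw [bernoulliKernel, norm_div, Complex.norm_exp]
    simp
  rw [hn, div_le_iff₀ (hκ.trans_le h1)]
  rcases le_total 0 z.re with h0 | h0
  · rw [abs_of_nonneg h0]
    calc Real.exp (z.re * y)
        ≤ Real.exp (-(min y (1 - y) * z.re) + z.re) := Real.exp_le_exp.2 (by
          nlinarith [mul_le_mul_of_nonneg_right (min_le_right y (1 - y)) h0])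
      _ = κ⁻¹ * Real.exp (-(min y (1 - y) * z.re)) * (κ * Real.exp z.re) := by
          rw [Real.exp_add]; field_simp
      _ ≤ _ := by gcongr
  · rw [abs_of_nonpos h0]
    calc Real.exp (z.re * y)
        ≤ Real.exp (-(min y (1 - y) * -z.re)) := Real.exp_le_exp.2 (by
          nlinarith [mul_le_mul_of_nonneg_right (min_le_left y (1 - y)) (neg_nonneg.2 h0)])
      _ = κ⁻¹ * Real.exp (-(min y (1 - y) * -z.re)) * κ := by field_simp
      _ ≤ _ := by gcongr

/-- Two complex numbers that are not real multiples of each other give a basis of real linear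
functionals `t ↦ Re (u t)`, `t ↦ Re (v t)`. -/
theorem exists_norm_le_abs_re_add {u v : ℂ} (h : (u / v).im ≠ 0) :
    ∃ c > 0, ∀ t : ℂ, c * ‖t‖ ≤ |(u * t).re| + |(v * t).re| := by
  have hD : u.im * v.re - u.re * v.im ≠ 0 := by
    intro h0
    apply h
    rw [Complex.div_im, ← sub_div, h0, zero_div]
  set D := u.im * v.re - u.re * v.im with hDdef
  have hM : 0 < ‖u‖ + ‖v‖ := by
    have : u ≠ 0 := by rintro rfl; simp at h
    positivity
  refine ⟨|D| / (‖u‖ + ‖v‖), by positivity, fun t => ?_⟩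
  rw [div_mul_eq_mul_div, div_le_iff₀ hM]
  -- Cramer's rule
  have key : (D : ℂ) * t =
      I * (((v * t).re : ℂ) * starRingEnd ℂ u - ((u * t).re : ℂ) * starRingEnd ℂ v) := by
    apply Complex.ext <;> simp [hDdef] <;> ring
  calc |D| * ‖t‖ = ‖(D : ℂ) * t‖ := by rw [norm_mul, Complex.norm_real, Real.norm_eq_abs]
    _ ≤ |(v * t).re| * ‖u‖ + |(u * t).re| * ‖v‖ := by
      rw [key, norm_mul, Complex.norm_I, one_mul]
      refine (norm_sub_le _ _).trans (le_of_eq ?_)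
      simp only [norm_mul, Complex.norm_real, Real.norm_eq_abs, Complex.norm_conj]
    _ ≤ _ := by
      nlinarith [abs_nonneg (v * t).re, abs_nonneg (u * t).re, norm_nonneg u, norm_nonneg v]

/-- On any set at positive distance from the poles the kernel is bounded, and it decays
exponentially in all directions if `0 < y`. -/
theorem exists_norm_barnesKernel_le {n : ℕ} (hn : 2 ≤ n) {ω : Fin n → ℂ}
    (hIm : ∀ j k, j ≠ k → (ω j / ω k).im ≠ 0) {y : ℝ} (hy0 : 0 ≤ y) (hy1 : y < 1)
    {δ : ℝ} (hδ : 0 < δ) :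
    ∃ κ : ℝ, 0 ≤ κ ∧ (0 < y → 0 < κ) ∧ ∃ C > 0, ∀ t : ℂ,
      (∀ j, ∀ m : ℤ, δ ≤ ‖ω j * t - m * (2 * Real.pi * I)‖) →
        ‖barnesKernel ω y t‖ ≤ C * Real.exp (-(κ * ‖t‖)) := by
  obtain ⟨C, hC, h⟩ := exists_norm_bernoulliKernel_le (y := y) hδ
  let a : Fin n := ⟨0, by omega⟩
  let b : Fin n := ⟨1, by omega⟩
  have hab : a ≠ b := by simp [a, b]
  obtain ⟨c, hc, hc'⟩ := exists_norm_le_abs_re_add (hIm a b hab)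
  have hmin : 0 ≤ min y (1 - y) := le_min hy0 (by linarith)
  refine ⟨min y (1 - y) * c, by positivity, fun hy => ?_, C ^ n, by positivity, fun t ht => ?_⟩
  · have : 0 < min y (1 - y) := lt_min hy (by linarith)
    positivity
  calc ‖barnesKernel ω y t‖ = ∏ j, ‖bernoulliKernel y (ω j * t)‖ := norm_prod _ _
    _ ≤ ∏ j, C * Real.exp (-(min y (1 - y) * |(ω j * t).re|)) :=
      Finset.prod_le_prod (fun _ _ => norm_nonneg _) fun j _ => h _ (ht j)
    _ = C ^ n * Real.exp (-(min y (1 - y) * ∑ j, |(ω j * t).re|)) := by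
      rw [Finset.prod_mul_distrib, ← Real.exp_sum, Finset.sum_neg_distrib, ← Finset.mul_sum]
      simp
    _ ≤ _ := by
      refine mul_le_mul_of_nonneg_left (Real.exp_le_exp.2 (neg_le_neg ?_)) (by positivity)
      rw [mul_assoc]
      refine mul_le_mul_of_nonneg_left ((hc' t).trans ?_) hmin
      rw [← Finset.sum_pair (f := fun j => |(ω j * t).re|) hab]
      exact Finset.sum_le_sum_of_subset_of_nonneg (Finset.subset_univ _)
        fun _ _ _ => abs_nonneg _

theorem exists_zpow_mul_exp_le {κ : ℝ} (hκ : 0 ≤ κ) {q : ℤ} (h : 0 < κ ∨ q ≤ -2) :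
    ∃ K > 0, ∀ R : ℝ, 1 ≤ R → R ^ q * Real.exp (-(κ * R)) ≤ K * R ^ (-2 : ℤ) := by
  rcases h with h | h
  · set N := (q + 2).toNat with hN
    refine ⟨N.factorial / κ ^ N, by positivity, fun R hR => ?_⟩
    have hR0 : 0 < R := by linarith
    have h1 : R ^ q ≤ R ^ (-2 : ℤ) * R ^ N := by
      rw [← zpow_natCast, ← zpow_add₀ hR0.ne']
      exact zpow_le_zpow_right₀ hR (by omega)
    have h2 := Real.pow_div_factorial_le_exp (κ * R) (by positivity) N
    have h3 : R ^ N ≤ N.factorial / κ ^ N * Real.exp (κ * R) := by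
      rw [mul_pow, div_le_iff₀ (by positivity)] at h2
      rw [div_mul_eq_mul_div, le_div_iff₀ (by positivity)]
      linarith
    calc R ^ q * Real.exp (-(κ * R))
        ≤ R ^ (-2 : ℤ) * (N.factorial / κ ^ N * Real.exp (κ * R)) * Real.exp (-(κ * R)) := by
          gcongr
          exact h1.trans (by gcongr)
      _ = _ := by
          have : Real.exp (κ * R) * Real.exp (-(κ * R)) = 1 := by rw [← Real.exp_add]; simp
          linear_combination (R ^ (-2 : ℤ) * (N.factorial / κ ^ N)) * this
  · refine ⟨1, one_pos, fun R hR => ?_⟩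
    rw [one_mul]
    have h1 : R ^ q ≤ R ^ (-2 : ℤ) := zpow_le_zpow_right₀ hR h
    have h2 : Real.exp (-(κ * R)) ≤ 1 := Real.exp_le_one_iff.2 (by nlinarith)
    have h3 : 0 < R ^ q := zpow_pos (by linarith) q
    nlinarith [Real.exp_pos (-(κ * R))]

/-! ### Summability of the residues -/

theorem barnesTerm_eq {n : ℕ} (ω : Fin n → ℂ) (y : ℝ) (l : ℤ) (k : Fin n) (m : ℤ) :
    barnesTerm ω y l k m = (ω k)⁻¹ *
      (∏ j ∈ Finset.univ.erase k, bernoulliKernel y (ω j * (2 * m * Real.pi * I / ω k))) *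
      (2 * m * Real.pi * I / ω k) ^ ((n : ℤ) - l - 1) * exp (2 * m * Real.pi * I * y) := by
  have h (j) : 2 * m * Real.pi * I * ω j / ω k = ω j * (2 * m * Real.pi * I / ω k) := by ring
  simp only [barnesTerm, bernoulliKernel, h, div_eq_mul_inv]

theorem summable_barnesTerm {n : ℕ} (hn : 2 ≤ n) {ω : Fin n → ℂ}
    (hIm : ∀ j k, j ≠ k → (ω j / ω k).im ≠ 0) {y : ℝ} (hy0 : 0 ≤ y) (hy1 : y < 1)
    {l : ℤ} (hl : y = 0 → (n : ℤ) < l) (k : Fin n) :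
    Summable fun m : {m : ℤ // m ≠ 0} => barnesTerm ω y l k m := by
  have hpi := Real.pi_pos
  set q : ℤ := (n : ℤ) - l - 1 with hq
  set c : ℝ := min y (1 - y)
  have hc : 0 ≤ c := le_min hy0 (by linarith)
  have hre (j : Fin n) (m : ℤ) : (ω j * (2 * m * Real.pi * I / ω k)).re =
      -(2 * Real.pi * (ω j / ω k).im * m) := by
    have : ω j * (2 * m * Real.pi * I / ω k) = ((2 * Real.pi * m : ℝ) : ℂ) * (I * (ω j / ω k)) := by
      push_cast; ring
    rw [this, Complex.re_ofReal_mul, Complex.I_mul_re]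
    ring
  have hb (j : Fin n) (hj : j ∈ Finset.univ.erase k) : ∃ C > 0, ∀ m : ℤ, m ≠ 0 →
      ‖bernoulliKernel y (ω j * (2 * m * Real.pi * I / ω k))‖ ≤
        C * Real.exp (-(c * (2 * Real.pi * |(ω j / ω k).im|) * |(m : ℝ)|)) := by
    have hjk := hIm j k (Finset.ne_of_mem_erase hj)
    have hδ : 0 < 2 * Real.pi * |(ω j / ω k).im| := by positivity
    obtain ⟨C, hC, h⟩ := exists_norm_bernoulliKernel_le (y := y) hδ
    refine ⟨C, hC, fun m hm => ?_⟩
    have habs : |(ω j * (2 * m * Real.pi * I / ω k)).re| =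
        2 * Real.pi * |(ω j / ω k).im| * |(m : ℝ)| := by
      rw [hre, abs_neg, abs_mul, abs_mul, abs_of_pos (by positivity : 0 < 2 * Real.pi)]
    refine (h _ fun m' => ?_).trans (le_of_eq ?_)
    · have h1 := Complex.abs_re_le_norm
        (ω j * (2 * m * Real.pi * I / ω k) - m' * (2 * Real.pi * I))
      have h2 : (ω j * (2 * m * Real.pi * I / ω k) - m' * (2 * Real.pi * I)).re =
          (ω j * (2 * m * Real.pi * I / ω k)).re := by simp
      rw [h2, habs] at h1
      have h3 : (1 : ℝ) ≤ |(m : ℝ)| := by exact_mod_cast Int.one_le_abs hm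
      nlinarith
    · rw [habs, mul_assoc c]
  choose! C hC hb using hb
  set κ : ℝ := ∑ j ∈ Finset.univ.erase k, c * (2 * Real.pi * |(ω j / ω k).im|) with hκ
  have hκ0 : 0 ≤ κ := Finset.sum_nonneg fun j _ => by positivity
  have hκq : 0 < κ ∨ q ≤ -2 := by
    rcases hy0.eq_or_lt with h | h
    · right
      have := hl h.symm
      omega
    · left
      have hc0 : 0 < c := lt_min h (by linarith)
      refine Finset.sum_pos (fun j hj => ?_) ?_
      · have := hIm j k (Finset.ne_of_mem_erase hj)
        positivity
      · rw [← Finset.card_pos, Finset.card_erase_of_mem (Finset.mem_univ k)]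
        simp
        omega
  obtain ⟨K, hK, hKR⟩ := exists_zpow_mul_exp_le hκ0 hκq
  set A : ℝ := ‖(ω k)⁻¹‖ * (∏ j ∈ Finset.univ.erase k, C j) * ‖2 * Real.pi * I / ω k‖ ^ q with hA
  have hP : 0 ≤ ∏ j ∈ Finset.univ.erase k, C j := Finset.prod_nonneg fun j hj => (hC j hj).le
  have hA0 : 0 ≤ A := by positivity
  have hs : Summable fun m : ℤ => A * K * (1 / (m : ℝ) ^ 2) :=
    (Real.summable_one_div_int_pow.2 one_lt_two).mul_left _
  refine Summable.of_norm_bounded (hs.comp_injective Subtype.val_injective) ?_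
  rintro ⟨m, hm⟩
  have h3 : (1 : ℝ) ≤ |(m : ℝ)| := by exact_mod_cast Int.one_le_abs hm
  have hexp : ‖exp (2 * m * Real.pi * I * y)‖ = 1 := by
    rw [Complex.norm_exp]
    simp
  have hsp : 2 * m * Real.pi * I / ω k = m * (2 * Real.pi * I / ω k) := by ring
  have hpr : ‖∏ j ∈ Finset.univ.erase k, bernoulliKernel y (ω j * (2 * m * Real.pi * I / ω k))‖ ≤
      (∏ j ∈ Finset.univ.erase k, C j) * Real.exp (-(κ * |(m : ℝ)|)) := by
    rw [norm_prod]
    refine (Finset.prod_le_prod (fun _ _ => norm_nonneg _) fun j hj => hb j hj m hm).trans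
      (le_of_eq ?_)
    rw [Finset.prod_mul_distrib, ← Real.exp_sum, Finset.sum_neg_distrib, ← Finset.sum_mul]
  have hm2 : |(m : ℝ)| ^ (-2 : ℤ) = 1 / (m : ℝ) ^ 2 := by
    rw [zpow_neg, one_div]
    congr 1
    exact_mod_cast sq_abs (m : ℝ)
  have hmn : ‖(m : ℂ)‖ = |(m : ℝ)| := Complex.norm_intCast m
  calc ‖barnesTerm ω y l k m‖
      = ‖(ω k)⁻¹‖ * ‖∏ j ∈ Finset.univ.erase k,
          bernoulliKernel y (ω j * (2 * m * Real.pi * I / ω k))‖ *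
          (|(m : ℝ)| ^ q * ‖2 * Real.pi * I / ω k‖ ^ q) := by
        rw [barnesTerm_eq, norm_mul, hexp, mul_one, norm_mul, norm_mul, norm_zpow]
        congr 1
        rw [hsp, norm_mul, mul_zpow, hmn]
    _ ≤ ‖(ω k)⁻¹‖ * ((∏ j ∈ Finset.univ.erase k, C j) * Real.exp (-(κ * |(m : ℝ)|))) *
          (|(m : ℝ)| ^ q * ‖2 * Real.pi * I / ω k‖ ^ q) := by gcongr
    _ = A * (|(m : ℝ)| ^ q * Real.exp (-(κ * |(m : ℝ)|))) := by rw [hA]; ring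
    _ ≤ A * (K * |(m : ℝ)| ^ (-2 : ℤ)) := by
        exact mul_le_mul_of_nonneg_left (hKR _ h3) hA0
    _ = A * K * (1 / (m : ℝ) ^ 2) := by rw [hm2]; ring

/-! ### Radii avoiding finitely many arithmetic progressions -/

/-- For finitely many progressions `d k * ℤ`, all intervals of length `1` contain intervals of a
fixed length that meet none of the progressions. Progressions are avoided one at a time, passing to
the first or the last third of an interval that contains at most one of its points. -/
theorem exists_gap {ι : Type*} (s : Finset ι) {d : ι → ℝ} (hd : ∀ k ∈ s, 0 < d k) :
    ∃ δ > 0, ∀ x : ℝ, ∃ a, x ≤ a ∧ a + δ ≤ x + 1 ∧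
      ∀ k ∈ s, ∀ m : ℤ, m * d k ≤ a ∨ a + δ ≤ m * d k := by
  classical
  induction s using Finset.induction_on with
  | empty => exact ⟨1, one_pos, fun x => ⟨x, le_rfl, le_rfl, by simp⟩⟩
  | insert b s hb ih =>
    obtain ⟨δ, hδ, h⟩ := ih fun k hk => hd k (Finset.mem_insert_of_mem hk)
    have hdb := hd b (Finset.mem_insert_self b s)
    set ε := min δ (d b) / 3 with hε
    have hε0 : 0 < ε := by positivity
    have h1 : 3 * ε ≤ δ := by rw [hε]; linarith [min_le_left δ (d b)]
    have h2 : 3 * ε ≤ d b := by rw [hε]; linarith [min_le_right δ (d b)]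
    refine ⟨ε, hε0, fun x => ?_⟩
    obtain ⟨a, ha1, ha2, ha⟩ := h x
    by_cases hm : ∃ m : ℤ, a < m * d b ∧ m * d b < a + ε
    · obtain ⟨m, hm1, hm2⟩ := hm
      refine ⟨a + 2 * ε, by linarith, by linarith, fun k hk m' => ?_⟩
      rcases Finset.mem_insert.1 hk with rfl | hk
      · rcases le_or_gt m' m with hle | hlt
        · left
          have : (m' : ℝ) ≤ m := by exact_mod_cast hle
          nlinarith
        · right
          have : (m : ℝ) + 1 ≤ m' := by exact_mod_cast hlt
          nlinarith
      · rcases ha k hk m' with h | h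
        · left; linarith
        · right; linarith
    · push Not at hm
      refine ⟨a, ha1, by linarith, fun k hk m' => ?_⟩
      rcases Finset.mem_insert.1 hk with rfl | hk
      · by_contra hcon
        push Not at hcon
        linarith [hm m' hcon.1]
      · rcases ha k hk m' with h | h
        · left; linarith
        · right; linarith

/-- There are arbitrarily large circles around the origin at positive distance from the poles of
the kernel. -/
theorem exists_radii {n : ℕ} {ω : Fin n → ℂ} (hω : ∀ j, ω j ≠ 0) :
    ∃ δ > 0, ∀ x : ℝ, ∃ R, x ≤ R ∧ ∀ t : ℂ, ‖t‖ = R →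
      ∀ j, ∀ m : ℤ, δ ≤ ‖ω j * t - m * (2 * Real.pi * I)‖ := by
  have hpi := Real.pi_pos
  have hωp (j) : 0 < ‖ω j‖ := norm_pos_iff.2 (hω j)
  obtain ⟨δ, hδ, h⟩ := exists_gap Finset.univ (d := fun k => 2 * Real.pi / ‖ω k‖)
    fun k _ => by have := hωp k; positivity
  obtain ⟨c, hc0, hc⟩ : ∃ c > 0, ∀ j, c ≤ ‖ω j‖ := by
    rcases isEmpty_or_nonempty (Fin n) with he | he
    · exact ⟨1, one_pos, fun j => he.elim j⟩
    · obtain ⟨i, hi⟩ := Finite.exists_min fun j => ‖ω j‖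
      exact ⟨_, hωp i, hi⟩
  refine ⟨c * (δ / 2), by positivity, fun x => ?_⟩
  obtain ⟨a, ha1, -, ha⟩ := h x
  refine ⟨a + δ / 2, by linarith, fun t ht j m => ?_⟩
  have h1 : |‖ω j * t‖ - ‖(m : ℂ) * (2 * Real.pi * I)‖| ≤ ‖ω j * t - m * (2 * Real.pi * I)‖ :=
    abs_norm_sub_norm_le _ _
  have h2 : ‖(m : ℂ) * (2 * Real.pi * I)‖ = ‖ω j‖ * ((|m| : ℤ) * (2 * Real.pi / ‖ω j‖)) := by
    have := (hωp j).ne'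
    rw [norm_mul, Complex.norm_intCast]
    simp only [norm_mul, Complex.norm_ofNat, Complex.norm_real, Real.norm_eq_abs,
      Complex.norm_I, abs_of_pos hpi, Int.cast_abs]
    field_simp
  rw [norm_mul, ht, h2, ← mul_sub, abs_mul, abs_norm] at h1
  refine le_trans (mul_le_mul (hc j) ?_ (by positivity) (norm_nonneg _)) h1
  rcases ha j (Finset.mem_univ j) |m| with h | h
  · exact le_trans (by linarith) (le_abs_self _)
  · exact le_trans (by linarith) (neg_le_abs _)

/-! ### The residue theorem for simple poles -/

/-- The residue theorem on a disc for a function whose only singularities are isolated points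
`p i` at which `(z - p i) f z` has a limit `r i` (a simple pole, or a removable singularity if
`r i = 0`). The poles are removed one at a time by subtracting the principal part. -/
theorem circleIntegral_eq_sum_residues {ι : Type*} (s : Finset ι) {p r : ι → ℂ} {f : ℂ → ℂ}
    {U : Set ℂ} (hU : IsOpen U) {c : ℂ} {R : ℝ} (hR : 0 ≤ R) (hsub : Metric.closedBall c R ⊆ U)
    (hp : ∀ i ∈ s, p i ∈ Metric.ball c R) (hinj : Set.InjOn p s)
    (hf : DifferentiableOn ℂ f (U \ p '' s))
    (hres : ∀ i ∈ s, Tendsto (fun z => (z - p i) * f z) (𝓝[≠] (p i)) (𝓝 (r i))) :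
    ∮ z in C(c, R), f z = 2 * Real.pi * I * ∑ i ∈ s, r i := by
  classical
  induction s using Finset.induction_on generalizing f with
  | empty =>
    simp only [Finset.coe_empty, Set.image_empty, Set.sdiff_empty] at hf
    simp only [Finset.sum_empty, mul_zero]
    exact circleIntegral_eq_zero_of_differentiable_on_off_countable hR Set.countable_empty
      (hf.continuousOn.mono hsub) fun z hz =>
        hf.differentiableAt (hU.mem_nhds (hsub (Metric.ball_subset_closedBall hz.1)))
  | insert a s ha ih =>
    have hpa := hp a (Finset.mem_insert_self a s)
    have hne : ∀ i ∈ s, p i ≠ p a := fun i hi h =>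
      ha (hinj (Finset.mem_coe.2 (Finset.mem_insert_of_mem hi))
        (Finset.mem_coe.2 (Finset.mem_insert_self a s)) h ▸ hi)
    set g₀ : ℂ → ℂ := fun z => f z - r a * (z - p a)⁻¹ with hg₀
    set g := Function.update g₀ (p a) (limUnder (𝓝[≠] (p a)) g₀) with hg
    have hgeq : ∀ z, z ≠ p a → g z = g₀ z := fun z hz => Function.update_of_ne hz _ _
    have hopen : IsOpen (U \ p '' s) :=
      hU.sdiff (s.finite_toSet.image p).isClosed
    have hmem : p a ∈ U \ p '' s := by
      refine ⟨hsub (Metric.ball_subset_closedBall hpa), ?_⟩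
      rintro ⟨i, hi, h⟩
      exact hne i hi h
    have hdiff : DifferentiableOn ℂ g (U \ p '' s) := by
      refine differentiableOn_update_limUnder_of_isLittleO (hopen.mem_nhds hmem) ?_ ?_
      · refine DifferentiableOn.sub (hf.mono ?_) ?_
        · rintro z ⟨⟨hz1, hz2⟩, hz3⟩
          refine ⟨hz1, ?_⟩
          rw [Finset.coe_insert, Set.image_insert_eq]
          exact fun h => h.elim hz3 hz2
        · refine (DifferentiableOn.inv (by fun_prop) ?_).const_mul _
          rintro z ⟨-, hz3⟩
          exact sub_ne_zero.2 hz3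
      · rw [Asymptotics.isLittleO_iff_tendsto']
        · have h1 := (hres a (Finset.mem_insert_self a s)).sub_const (r a)
          have h2 : Tendsto (fun z => (z - p a) * g₀ (p a)) (𝓝[≠] (p a)) (𝓝 0) := by
            have : Tendsto (fun z => (z - p a) * g₀ (p a)) (𝓝 (p a))
                (𝓝 ((p a - p a) * g₀ (p a))) := Continuous.tendsto (by fun_prop) _
            rw [sub_self, zero_mul] at this
            exact this.mono_left nhdsWithin_le_nhds
          have h3 := h1.sub h2
          rw [sub_self, sub_zero] at h3
          refine h3.congr' ?_
          filter_upwards [self_mem_nhdsWithin] with z hz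
          have hz : z - p a ≠ 0 := sub_ne_zero.2 hz
          rw [div_inv_eq_mul]
          simp only [hg₀]
          field_simp
        · filter_upwards [self_mem_nhdsWithin] with z hz h
          exact absurd (inv_eq_zero.1 h) (sub_ne_zero.2 hz)
    have hih := ih (f := g) (fun i hi => hp i (Finset.mem_insert_of_mem hi))
      (hinj.mono (by simp)) hdiff (fun i hi => by
        have h1 := hres i (Finset.mem_insert_of_mem hi)
        have hc : ContinuousAt (fun z => (z - p i) * (r a * (z - p a)⁻¹)) (p i) := by
          have := sub_ne_zero.2 (hne i hi)
          fun_prop (disch := assumption)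
        have h2 := h1.sub (hc.tendsto.mono_left nhdsWithin_le_nhds)
        simp only [sub_self, zero_mul, sub_zero] at h2
        refine h2.congr' ?_
        filter_upwards [nhdsWithin_le_nhds (isOpen_ne.mem_nhds (hne i hi))] with z hz
        rw [hgeq z hz]
        simp only [hg₀]
        ring)
    have hsph : ∀ z ∈ Metric.sphere c R, ∀ i ∈ insert a s, z ≠ p i := by
      rintro z hz i hi rfl
      have h1 := hp i hi
      rw [Metric.mem_ball] at h1
      rw [Metric.mem_sphere] at hz
      linarith
    have hgi : CircleIntegrable g c R := by
      refine ContinuousOn.circleIntegrable hR (hdiff.continuousOn.mono fun z hz => ?_)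
      refine ⟨hsub (Metric.sphere_subset_closedBall hz), ?_⟩
      rintro ⟨i, hi, rfl⟩
      exact hsph _ hz i (Finset.mem_insert_of_mem hi) rfl
    have hii : CircleIntegrable (fun z => r a * (z - p a)⁻¹) c R := by
      refine ContinuousOn.circleIntegrable hR ?_
      refine continuousOn_const.mul (ContinuousOn.inv₀ (by fun_prop) fun z hz => ?_)
      exact sub_ne_zero.2 (hsph z hz a (Finset.mem_insert_self a s))
    have hfe : ∮ z in C(c, R), f z = ∮ z in C(c, R), (g z + r a * (z - p a)⁻¹) := by
      refine circleIntegral.integral_congr hR fun z hz => ?_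
      simp only [hgeq z (hsph z hz a (Finset.mem_insert_self a s)), hg₀]
      ring
    rw [hfe, circleIntegral.integral_add hgi hii, hih, circleIntegral.integral_const_mul,
      circleIntegral.integral_sub_inv_of_mem_ball hpa, Finset.sum_insert ha]
    ring

/-! ### The series as a limit of contour integrals -/

theorem differentiableAt_bernoulliKernel {y : ℝ} {z : ℂ} (hz : exp z ≠ 1) :
    DifferentiableAt ℂ (bernoulliKernel y) z := by
  have := sub_ne_zero.2 hz
  unfold bernoulliKernel
  fun_prop (disch := assumption)

theorem differentiableAt_barnesKernel {n : ℕ} {ω : Fin n → ℂ} {y : ℝ} {t : ℂ}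
    (h : ∀ j, exp (ω j * t) ≠ 1) : DifferentiableAt ℂ (barnesKernel ω y) t := by
  unfold barnesKernel
  refine DifferentiableAt.fun_finsetProd fun j _ => ?_
  exact (differentiableAt_bernoulliKernel (h j)).comp t (by fun_prop)

theorem exp_mul_pole_ne_one {n : ℕ} {ω : Fin n → ℂ} (hIm : ∀ j k, j ≠ k → (ω j / ω k).im ≠ 0)
    {j k : Fin n} (hjk : j ≠ k) {m : ℤ} (hm : m ≠ 0) :
    exp (ω j * (2 * m * Real.pi * I / ω k)) ≠ 1 := by
  intro h
  obtain ⟨m', hm'⟩ := Complex.exp_eq_one_iff.1 h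
  have h2 : ω j * (2 * m * Real.pi * I / ω k) = (m * (ω j / ω k)) * (2 * Real.pi * I) := by ring
  rw [h2] at hm'
  have h3 := congrArg Complex.im (mul_right_cancel₀ Complex.two_pi_I_ne_zero hm')
  simp only [Complex.mul_im, Complex.intCast_re, Complex.intCast_im, zero_mul, add_zero] at h3
  rcases mul_eq_zero.1 h3 with h4 | h4
  · exact hm (by exact_mod_cast h4)
  · exact hIm j k hjk h4

/-- The terms of the series are the residues of `t ^ (n - l - 1) * barnesKernel ω y t` at its
nonzero poles. -/
theorem tendsto_residue_barnesKernel {n : ℕ} {ω : Fin n → ℂ} (hω : ∀ j, ω j ≠ 0)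
    (hIm : ∀ j k, j ≠ k → (ω j / ω k).im ≠ 0) (y : ℝ) (l : ℤ) (k : Fin n) {m : ℤ} (hm : m ≠ 0) :
    Tendsto (fun t => (t - 2 * m * Real.pi * I / ω k) *
        (t ^ ((n : ℤ) - l - 1) * barnesKernel ω y t))
      (𝓝[≠] (2 * m * Real.pi * I / ω k)) (𝓝 (barnesTerm ω y l k m)) := by
  set p : ℂ := 2 * m * Real.pi * I / ω k with hp
  have hωp : ω k * p = m * (2 * Real.pi * I) := by
    rw [hp, mul_div_cancel₀ _ (hω k)]; ring
  have hp0 : p ≠ 0 := by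
    intro h
    rw [h, mul_zero] at hωp
    have := mul_ne_zero (Int.cast_ne_zero.2 hm : (m : ℂ) ≠ 0) Complex.two_pi_I_ne_zero
    exact this hωp.symm
  have hexp : exp (ω k * p) = 1 := by rw [hωp]; exact Complex.exp_int_mul_two_pi_mul_I m
  have h1 : Tendsto (fun t => (t - p) / (exp (ω k * t) - 1)) (𝓝[≠] p) (𝓝 (ω k)⁻¹) := by
    have hd : HasDerivAt (fun t => exp (ω k * t)) (ω k) p := by
      have := ((hasDerivAt_id p).const_mul (ω k)).cexp
      simpa [hexp] using this
    have := (hasDerivAt_iff_tendsto_slope.1 hd).inv₀ (hω k)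
    refine this.congr fun t => ?_
    rw [slope_def_field, hexp, inv_div]
  have h2 : ContinuousAt (fun t => (∏ j ∈ Finset.univ.erase k, bernoulliKernel y (ω j * t)) *
      t ^ ((n : ℤ) - l - 1) * exp (ω k * t * y)) p := by
    refine (ContinuousAt.mul (tendsto_finsetProd _ fun j hj => ?_)
      (continuousAt_zpow₀ _ _ (Or.inl hp0))).mul (by fun_prop)
    exact ((differentiableAt_bernoulliKernel
      (exp_mul_pole_ne_one hIm (Finset.ne_of_mem_erase hj) hm)).continuousAt).comp
        (f := fun t => ω j * t) (by fun_prop)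
  have h3 := h1.mul (h2.tendsto.mono_left nhdsWithin_le_nhds)
  have h4 : (ω k)⁻¹ * ((∏ j ∈ Finset.univ.erase k, bernoulliKernel y (ω j * p)) *
      p ^ ((n : ℤ) - l - 1) * exp (ω k * p * y)) = barnesTerm ω y l k m := by
    have h5 : ω k * p * y = 2 * m * Real.pi * I * y := by rw [hωp]; ring
    rw [barnesTerm_eq, ← hp, h5]
    ring
  rw [h4] at h3
  refine h3.congr fun t => ?_
  rw [barnesKernel, ← Finset.mul_prod_erase _ _ (Finset.mem_univ k)]
  simp only [bernoulliKernel]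
  ring

/-- The integral over a circle of the principal part at the origin. -/
theorem circleIntegral_sum_bernoulliSum {n : ℕ} (ω : Fin n → ℂ) (y : ℝ) (l : ℤ) {R : ℝ}
    (hR : 0 < R) :
    ∮ t in C(0, R), ∑ i ∈ Finset.range (l + 1).toNat,
      bernoulliSum ω y i * (t - 0) ^ ((i : ℤ) - l - 1) =
        2 * Real.pi * I * bernoulliSum ω y l := by
  have hci (k : ℤ) : CircleIntegrable (fun t : ℂ => (t - 0) ^ k) 0 R :=
    circleIntegrable_sub_zpow_iff.2 (by simp [abs_of_pos hR, hR.ne])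
  have hci' (i : ℕ) : CircleIntegrable
      (fun t : ℂ => bernoulliSum ω y i * (t - 0) ^ ((i : ℤ) - l - 1)) 0 R :=
    CircleIntegrable.const_fun_smul (hci _)
  rw [circleIntegral.integral_fun_sum fun i _ => hci' i]
  simp only [circleIntegral.integral_const_mul]
  rcases lt_or_ge l 0 with hl | hl
  · rw [Int.toNat_of_nonpos (by omega), Finset.sum_range_zero, bernoulliSum, if_neg (by omega),
      mul_zero]
  · lift l to ℕ using hl
    rw [Finset.sum_eq_single l]
    · have : (l : ℤ) - l - 1 = -1 := by ring
      rw [this]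
      simp only [zpow_neg_one]
      rw [circleIntegral.integral_sub_center_inv 0 hR.ne', mul_comm]
    · intro i _ hi
      rw [circleIntegral.integral_sub_zpow_of_ne (by omega), mul_zero]
    · intro h
      exact absurd (Finset.mem_range.2 (by omega)) h

/-- The nonzero poles `2πim / ω k` in the disc of radius `R`, for given `k`. -/
noncomputable def polesIn {n : ℕ} (ω : Fin n → ℂ) (R : ℝ) (k : Fin n) : Finset {m : ℤ // m ≠ 0} :=
  ((Finset.Icc (-⌈R * ‖ω k‖⌉) ⌈R * ‖ω k‖⌉).subtype (· ≠ 0)).filter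
    fun m => ‖(2 * (m : ℤ) * Real.pi * I / ω k : ℂ)‖ < R

theorem mem_polesIn {n : ℕ} {ω : Fin n → ℂ} (hω : ∀ j, ω j ≠ 0) {R : ℝ} {k : Fin n}
    {m : {m : ℤ // m ≠ 0}} :
    m ∈ polesIn ω R k ↔ ‖(2 * (m : ℤ) * Real.pi * I / ω k : ℂ)‖ < R := by
  simp only [polesIn, Finset.mem_filter, Finset.mem_subtype, Finset.mem_Icc, and_iff_right_iff_imp,
    ← abs_le]
  intro h
  have hk : 0 < ‖ω k‖ := norm_pos_iff.2 (hω k)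
  have hn : ‖(2 * (m : ℤ) * Real.pi * I : ℂ)‖ = 2 * |((m : ℤ) : ℝ)| * Real.pi := by
    simp [abs_of_pos Real.pi_pos]
  rw [norm_div, hn, div_lt_iff₀ hk] at h
  have h1 : |((m : ℤ) : ℝ)| ≤ R * ‖ω k‖ := by
    nlinarith [Real.pi_gt_three, abs_nonneg ((m : ℤ) : ℝ)]
  have h2 := h1.trans (Int.le_ceil _)
  exact_mod_cast h2

theorem tendsto_polesIn {n : ℕ} {ω : Fin n → ℂ} (hω : ∀ j, ω j ≠ 0) (k : Fin n) :
    Tendsto (fun R => polesIn ω R k) atTop atTop := by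
  refine Monotone.tendsto_atTop_finset (fun R R' h m hm => ?_) fun m => ?_
  · rw [mem_polesIn hω] at hm ⊢
    exact hm.trans_le h
  · obtain ⟨R, hR⟩ := exists_gt ‖(2 * (m : ℤ) * Real.pi * I / ω k : ℂ)‖
    exact ⟨R, (mem_polesIn hω).2 hR⟩

/-- The residue theorem for `t ^ (n - l - 1) * barnesKernel ω y t` on a disc without poles on its
boundary. -/
theorem circleIntegral_barnesKernel {n : ℕ} {ω : Fin n → ℂ} (hω : ∀ j, ω j ≠ 0)
    (hIm : ∀ j k, j ≠ k → (ω j / ω k).im ≠ 0) (y : ℝ) (l : ℤ) {R : ℝ} (hR : 0 < R)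
    (hsph : ∀ t : ℂ, ‖t‖ = R → ∀ j, exp (ω j * t) ≠ 1) :
    ∮ t in C(0, R), t ^ ((n : ℤ) - l - 1) * barnesKernel ω y t =
      2 * Real.pi * I * (bernoulliSum ω y l +
        ∑ k, ∑ m ∈ polesIn ω R k, barnesTerm ω y l k m) := by
  set N := (l + 1).toNat with hN
  set q : ℤ := (n : ℤ) - l - 1 with hq
  set P : ℂ → ℂ := fun t => ∑ i ∈ Finset.range N, bernoulliSum ω y i * (t - 0) ^ ((i : ℤ) - l - 1)
    with hP
  set f : ℂ → ℂ := fun t => t ^ q * barnesKernel ω y t with hf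
  let p : Option (Σ _ : Fin n, {m : ℤ // m ≠ 0}) → ℂ :=
    fun o => o.elim 0 fun x => 2 * (x.2 : ℤ) * Real.pi * I / ω x.1
  let r : Option (Σ _ : Fin n, {m : ℤ // m ≠ 0}) → ℂ :=
    fun o => o.elim 0 fun x => barnesTerm ω y l x.1 x.2
  let s := Finset.insertNone (Finset.univ.sigma (polesIn ω R))
  have hne (x : Σ _ : Fin n, {m : ℤ // m ≠ 0}) : p (some x) ≠ 0 := by
    refine div_ne_zero ?_ (hω _)
    simp [x.2.2, Real.pi_ne_zero]
  have hpole (x : Σ _ : Fin n, {m : ℤ // m ≠ 0}) : exp (ω x.1 * p (some x)) = 1 := by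
    refine Complex.exp_eq_one_iff.2 ⟨x.2, ?_⟩
    simp only [p, Option.elim_some]
    rw [mul_div_cancel₀ _ (hω _)]
    ring
  have hinj : Function.Injective p := by
    rintro (_ | ⟨k, m⟩) (_ | ⟨k', m'⟩) h
    · rfl
    · exact absurd h.symm (hne _)
    · exact absurd h (hne _)
    · by_cases hk : k = k'
      · subst hk
        simp only [p, Option.elim_some] at h
        have h2 := (div_left_inj' (hω k)).1 h
        have h3 := mul_right_cancel₀ Complex.I_ne_zero h2
        have h4 := mul_right_cancel₀ (Complex.ofReal_ne_zero.2 Real.pi_ne_zero) h3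
        have h5 := mul_left_cancel₀ two_ne_zero h4
        have h6 : (m : ℤ) = m' := by exact_mod_cast h5
        rw [Subtype.ext h6]
      · exfalso
        have h1 := hpole ⟨k, m⟩
        rw [h] at h1
        exact exp_mul_pole_ne_one hIm hk m'.2 h1
  have hPd (t : ℂ) (ht : t ≠ 0) : DifferentiableAt ℂ P t := by
    simp only [hP, sub_zero]
    exact DifferentiableAt.fun_sum fun i _ =>
      (differentiableAt_zpow.2 (Or.inl ht)).const_mul _
  have hfd (t : ℂ) (ht : t ≠ 0) (h : ∀ j, exp (ω j * t) ≠ 1) : DifferentiableAt ℂ f t :=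
    (differentiableAt_zpow.2 (Or.inl ht)).mul (differentiableAt_barnesKernel h)
  -- an open neighbourhood of the closed disc without further poles
  let U : Set ℂ := {t | ∀ j, exp (ω j * t) ≠ 1} ∪ Metric.ball 0 R
  have hU : IsOpen U := by
    refine IsOpen.union ?_ Metric.isOpen_ball
    simp only [Set.ofPred_forall]
    exact isOpen_iInter_of_finite fun j => isOpen_ne_fun (by fun_prop) (by fun_prop)
  have key := circleIntegral_eq_sum_residues s (p := p) (r := r) (f := fun t => f t - P t) (U := U)
    (c := 0) (R := R) hU hR.le (fun t ht => by
      rw [mem_closedBall_zero_iff] at ht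
      rcases ht.eq_or_lt with h | h
      · exact Or.inl (hsph t h)
      · exact Or.inr (mem_ball_zero_iff.2 h)) (fun i hi => by
      rcases i with _ | ⟨k, m⟩
      · simpa [p] using hR
      · have hm : m ∈ polesIn ω R k := by simpa [s] using hi
        exact mem_ball_zero_iff.2 ((mem_polesIn hω).1 hm)) hinj.injOn (by
    rintro t ⟨htU, ht⟩
    have ht0 : t ≠ 0 := by
      rintro rfl
      exact ht ⟨none, by simp [s], rfl⟩
    refine ((hfd t ht0 fun j hj => ?_).sub (hPd t ht0)).differentiableWithinAt
    rcases htU with h | h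
    · exact h j hj
    · obtain ⟨m, hm⟩ := Complex.exp_eq_one_iff.1 hj
      have hm0 : m ≠ 0 := by
        rintro rfl
        rw [Int.cast_zero, zero_mul] at hm
        exact (mul_ne_zero (hω j) ht0) hm
      have htp : p (some ⟨j, ⟨m, hm0⟩⟩) = t := by
        simp only [p, Option.elim_some]
        rw [div_eq_iff (hω j), mul_comm t, hm]
        ring
      refine ht ⟨some ⟨j, ⟨m, hm0⟩⟩, ?_, htp⟩
      have : ⟨m, hm0⟩ ∈ polesIn ω R j := (mem_polesIn hω).2 (by
        have h2 := mem_ball_zero_iff.1 h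
        rw [← htp] at h2
        exact h2)
      simpa [s] using this) (by
    rintro (_ | ⟨k, m⟩) -
    · -- at the origin the principal part has been subtracted
      have hO := (barnesKernel_sub_isBigO hω y N).mul
        (Asymptotics.isBigO_refl (fun t : ℂ => t ^ (-l)) (𝓝[≠] 0))
      have hpos : 0 < (N - l).toNat := by omega
      have hlim : Tendsto (fun t : ℂ => t ^ (N - l).toNat) (𝓝[≠] 0) (𝓝 0) := by
        have : Tendsto (fun t : ℂ => t ^ (N - l).toNat) (𝓝 0) (𝓝 (0 ^ (N - l).toNat)) :=
          (continuous_pow _).tendsto 0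
        rw [zero_pow hpos.ne'] at this
        exact this.mono_left nhdsWithin_le_nhds
      refine (hO.congr' ?_ ?_).trans_tendsto hlim
      · filter_upwards [self_mem_nhdsWithin] with t ht
        have ht : t ≠ 0 := ht
        have e1 : t * t ^ q = t ^ n * t ^ (-l) := by
          rw [← zpow_natCast, ← zpow_add₀ ht, ← zpow_one_add₀ ht]
          congr 1
          omega
        have e2 : t * P t = (∑ i ∈ Finset.range N, bernoulliSum ω y i * t ^ i) * t ^ (-l) := by
          simp only [hP, sub_zero]
          rw [Finset.mul_sum, Finset.sum_mul]
          refine Finset.sum_congr rfl fun i _ => ?_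
          rw [mul_assoc, ← zpow_natCast, ← zpow_add₀ ht, mul_left_comm, ← zpow_one_add₀ ht]
          congr 2
          omega
        simp only [p, Option.elim_none, sub_zero, hf]
        linear_combination e2 - barnesKernel ω y t * e1
      · filter_upwards [self_mem_nhdsWithin] with t ht
        have ht : t ≠ 0 := ht
        rw [← zpow_natCast, ← zpow_natCast, ← zpow_add₀ ht]
        congr 1
        omega
    · have h1 := tendsto_residue_barnesKernel hω hIm y l k m.2
      have hc : ContinuousAt (fun t => (t - p (some ⟨k, m⟩)) * P t) (p (some ⟨k, m⟩)) :=
        (by fun_prop : ContinuousAt (fun t => t - p (some ⟨k, m⟩)) _).mul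
          (hPd _ (hne _)).continuousAt
      have h2 := h1.sub (hc.tendsto.mono_left nhdsWithin_le_nhds)
      simp only [sub_self, zero_mul, sub_zero] at h2
      refine h2.congr fun t => ?_
      simp only [p, Option.elim_some, hf]
      ring)
  have hsph0 : ∀ t ∈ Metric.sphere (0 : ℂ) R, t ≠ 0 := by
    rintro t ht rfl
    simp at ht
    exact hR.ne ht
  have hfi : CircleIntegrable f 0 R := ContinuousOn.circleIntegrable hR.le fun t ht =>
    (hfd t (hsph0 t ht) (hsph t (mem_sphere_zero_iff_norm.1 ht))).continuousAt.continuousWithinAt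
  have hPi : CircleIntegrable P 0 R := ContinuousOn.circleIntegrable hR.le fun t ht =>
    (hPd t (hsph0 t ht)).continuousAt.continuousWithinAt
  rw [circleIntegral.integral_sub hfi hPi, circleIntegral_sum_bernoulliSum ω y l hR,
    sub_eq_iff_eq_add] at key
  rw [key, Finset.sum_insertNone, Finset.sum_sigma]
  simp only [r, Option.elim_none, Option.elim_some]
  ring

/-- The residues at the nonzero poles add up to minus the residue at the origin. -/
theorem sum_tsum_barnesTerm {n : ℕ} (hn : 2 ≤ n) {ω : Fin n → ℂ} (hω : ∀ j, ω j ≠ 0)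
    (hIm : ∀ j k, j ≠ k → (ω j / ω k).im ≠ 0) {y : ℝ} (hy0 : 0 ≤ y) (hy1 : y < 1)
    {l : ℤ} (hl : y = 0 → (n : ℤ) < l) :
    ∑ k, ∑' m : {m : ℤ // m ≠ 0}, barnesTerm ω y l k m = -bernoulliSum ω y l := by
  obtain ⟨δ, hδ, hrad⟩ := exists_radii hω
  obtain ⟨κ, hκ, hκ', C, hC, hK⟩ := exists_norm_barnesKernel_le hn hIm hy0 hy1 hδ
  set q : ℤ := (n : ℤ) - l - 1 with hq
  obtain ⟨K, hK0, hKR⟩ := exists_zpow_mul_exp_le hκ (q := q) (by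
    rcases hy0.eq_or_lt with h | h
    · right
      have := hl h.symm
      omega
    · exact Or.inl (hκ' h))
  -- the contours are circles of radius `R N → ∞` at distance from the poles bounded below
  choose R hR hR' using fun N : ℕ => hrad (N + 1)
  have hR1 (N) : 1 ≤ R N := le_trans (by simp) (hR N)
  have hRtop : Tendsto R atTop atTop :=
    tendsto_atTop_mono (fun N => le_trans (by linarith) (hR N)) tendsto_natCast_atTop_atTop
  have hsph (N : ℕ) (t : ℂ) (ht : ‖t‖ = R N) (j) : exp (ω j * t) ≠ 1 := by
    intro h
    obtain ⟨m, hm⟩ := Complex.exp_eq_one_iff.1 h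
    have := hR' N t ht j m
    rw [hm, sub_self, norm_zero] at this
    linarith
  have hint : Tendsto (fun N => ∮ t in C(0, R N), t ^ q * barnesKernel ω y t) atTop (𝓝 0) := by
    have hlim : Tendsto (fun N => 2 * Real.pi * (C * K) * (R N)⁻¹) atTop (𝓝 0) := by
      simpa using (tendsto_inv_atTop_zero.comp hRtop).const_mul (2 * Real.pi * (C * K))
    refine squeeze_zero_norm (fun N => ?_) hlim
    have hR0 : 0 < R N := one_pos.trans_le (hR1 N)
    refine (circleIntegral.norm_integral_le_of_norm_le_const hR0.le
      (C := C * K * (R N) ^ (-2 : ℤ)) fun t ht => ?_).trans (le_of_eq ?_)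
    · have ht' := mem_sphere_zero_iff_norm.1 ht
      rw [norm_mul, norm_zpow, ht']
      calc R N ^ q * ‖barnesKernel ω y t‖
          ≤ R N ^ q * (C * Real.exp (-(κ * R N))) := by
            have := hK t (hR' N t ht')
            rw [ht'] at this
            exact mul_le_mul_of_nonneg_left this (by positivity)
        _ = C * (R N ^ q * Real.exp (-(κ * R N))) := by ring
        _ ≤ C * (K * R N ^ (-2 : ℤ)) := mul_le_mul_of_nonneg_left (hKR _ (hR1 N)) hC.le
        _ = _ := by ring
    · rw [zpow_neg, zpow_ofNat]
      field_simp
  have hsum : Tendsto (fun N => bernoulliSum ω y l +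
      ∑ k, ∑ m ∈ polesIn ω (R N) k, barnesTerm ω y l k m) atTop
      (𝓝 (bernoulliSum ω y l + ∑ k, ∑' m : {m : ℤ // m ≠ 0}, barnesTerm ω y l k m)) := by
    refine tendsto_const_nhds.add (tendsto_finsetSum _ fun k _ => ?_)
    exact (summable_barnesTerm hn hIm hy0 hy1 hl k).hasSum.comp
      ((tendsto_polesIn hω k).comp hRtop)
  have h0 : Tendsto (fun N => bernoulliSum ω y l +
      ∑ k, ∑ m ∈ polesIn ω (R N) k, barnesTerm ω y l k m) atTop (𝓝 0) := by
    have := hint.const_mul (2 * Real.pi * I)⁻¹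
    rw [mul_zero] at this
    refine this.congr fun N => ?_
    rw [circleIntegral_barnesKernel hω hIm y l (one_pos.trans_le (hR1 N)) (hsph N),
      inv_mul_cancel_left₀ Complex.two_pi_I_ne_zero]
  have := tendsto_nhds_unique hsum h0
  linear_combination this

/-! ### The multiple Dirichlet series as a Mellin transform -/

section DirichletSeries

open MeasureTheory

theorem norm_cpow_mul_exp_neg {t : ℝ} (ht : 0 < t) (a x : ℂ) :
    ‖(t : ℂ) ^ a * exp (-(x * t))‖ = t ^ a.re * Real.exp (-(x.re * t)) := by
  rw [norm_mul, Complex.norm_cpow_eq_rpow_re_of_pos ht, Complex.norm_exp]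
  simp

theorem continuousOn_cpow_mul_exp_neg (a x : ℂ) :
    ContinuousOn (fun t : ℝ => (t : ℂ) ^ a * exp (-(x * t))) (Set.Ioi 0) := by
  intro t ht
  have : (t : ℂ) ∈ slitPlane := Complex.ofReal_mem_slitPlane.2 ht
  exact (ContinuousAt.mul (ContinuousAt.cpow (by fun_prop) (by fun_prop) this)
    (by fun_prop)).continuousWithinAt

theorem integrableOn_rpow_mul_exp_neg {σ b : ℝ} (hσ : -1 < σ) (hb : 0 < b) :
    IntegrableOn (fun t : ℝ => t ^ σ * Real.exp (-(b * t))) (Set.Ioi 0) := by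
  simpa [neg_mul] using integrableOn_rpow_mul_exp_neg_mul_rpow hσ one_pos hb

theorem integrableOn_cpow_mul_exp_neg {a x : ℂ} (ha : -1 < a.re) (hx : 0 < x.re) :
    IntegrableOn (fun t : ℝ => (t : ℂ) ^ a * exp (-(x * t))) (Set.Ioi 0) := by
  refine Integrable.mono' (integrableOn_rpow_mul_exp_neg ha hx)
    ((continuousOn_cpow_mul_exp_neg a x).aestronglyMeasurable measurableSet_Ioi) ?_
  filter_upwards [ae_restrict_mem measurableSet_Ioi] with t ht
  exact (norm_cpow_mul_exp_neg ht a x).le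

theorem differentiableAt_integral_cpow_mul_exp_neg {s x : ℂ} (hs : 0 < s.re) (hx : 0 < x.re) :
    DifferentiableAt ℂ (fun x : ℂ => ∫ t in Set.Ioi (0 : ℝ), (t : ℂ) ^ (s - 1) * exp (-(x * t)))
      x := by
  have hε : 0 < x.re / 2 := by positivity
  have hball : ∀ z ∈ Metric.ball x (x.re / 2), x.re / 2 < z.re := by
    intro z hz
    have h1 := (Complex.abs_re_le_norm (z - x)).trans_lt (mem_ball_iff_norm.1 hz)
    rw [Complex.sub_re, abs_lt] at h1
    linarith
  have hs1 : (s - 1).re = s.re - 1 := by simp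
  refine (hasDerivAt_integral_of_dominated_loc_of_deriv_le
    (F := fun (x : ℂ) (t : ℝ) => (t : ℂ) ^ (s - 1) * exp (-(x * t)))
    (F' := fun (x : ℂ) (t : ℝ) => (t : ℂ) ^ (s - 1) * (exp (-(x * t)) * (-t)))
    (bound := fun t : ℝ => t ^ s.re * Real.exp (-(x.re / 2 * t)))
    (Metric.ball_mem_nhds x hε) ?_ ?_ ?_ ?_ ?_ ?_).2.differentiableAt
  · exact Eventually.of_forall fun z =>
      (continuousOn_cpow_mul_exp_neg _ z).aestronglyMeasurable measurableSet_Ioi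
  · exact integrableOn_cpow_mul_exp_neg (by rw [hs1]; linarith) hx
  · have h1 := (continuousOn_cpow_mul_exp_neg (s - 1) x).mul
      (continuous_ofReal.neg.continuousOn (s := Set.Ioi (0 : ℝ)))
    refine (h1.congr fun t _ => ?_).aestronglyMeasurable measurableSet_Ioi
    simp only [Pi.mul_apply, Pi.neg_apply]
    ring
  · filter_upwards [ae_restrict_mem measurableSet_Ioi] with t ht z hz
    have ht : 0 < t := ht
    rw [← mul_assoc, norm_mul, norm_cpow_mul_exp_neg ht, hs1, norm_neg, Complex.norm_real,
      Real.norm_of_nonneg ht.le]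
    have h1 : t ^ s.re = t ^ (s.re - 1) * t := by rw [Real.rpow_sub_one ht.ne']; field_simp
    rw [h1, mul_right_comm]
    gcongr
    exact (hball z hz).le
  · exact integrableOn_rpow_mul_exp_neg (by linarith) hε
  · filter_upwards with t z _
    have h1 : HasDerivAt (fun z : ℂ => -(z * t)) (-(t : ℂ)) z := by
      simpa using ((hasDerivAt_id z).mul_const (t : ℂ)).fun_neg
    exact h1.cexp.const_mul _

/-- The Gamma integral for a complex scaling parameter `x` with positive real part, by analytic
continuation in `x` from the positive reals. -/
theorem integral_cpow_mul_exp_neg {s x : ℂ} (hs : 0 < s.re) (hx : 0 < x.re) :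
    ∫ t in Set.Ioi (0 : ℝ), (t : ℂ) ^ (s - 1) * exp (-(x * t)) = x ^ (-s) * Gamma s := by
  have hopen : IsOpen {x : ℂ | 0 < x.re} := isOpen_lt continuous_const continuous_re
  have h1 : AnalyticOnNhd ℂ
      (fun x : ℂ => ∫ t in Set.Ioi (0 : ℝ), (t : ℂ) ^ (s - 1) * exp (-(x * t))) {x | 0 < x.re} :=
    DifferentiableOn.analyticOnNhd (fun x hx =>
      (differentiableAt_integral_cpow_mul_exp_neg hs hx).differentiableWithinAt) hopen
  have h2 : AnalyticOnNhd ℂ (fun x : ℂ => x ^ (-s) * Gamma s) {x | 0 < x.re} :=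
    DifferentiableOn.analyticOnNhd (fun x hx =>
      ((differentiableAt_id.cpow (differentiableAt_const _)
        (Or.inl hx)).mul_const _).differentiableWithinAt) hopen
  have hconn : IsPreconnected {x : ℂ | 0 < x.re} := (convex_halfSpace_re_gt 0).isPreconnected
  refine h1.eqOn_of_preconnected_of_frequently_eq h2 hconn (z₀ := 1) (by simp) ?_ hx
  have ht : Tendsto (fun r : ℝ => (r : ℂ)) (𝓝[>] 1) (𝓝[≠] 1) := by
    refine tendsto_nhdsWithin_iff.2 ⟨?_, ?_⟩
    · exact (continuous_ofReal.tendsto' 1 1 (by simp)).mono_left nhdsWithin_le_nhds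
    · filter_upwards [self_mem_nhdsWithin] with r hr h
      have hr1 : (r : ℂ) = 1 := h
      have : r = 1 := by exact_mod_cast hr1
      exact (ne_of_gt hr) this
  refine ht.frequently (Eventually.frequently ?_)
  filter_upwards [self_mem_nhdsWithin] with r hr
  have hr0 : 0 < r := one_pos.trans hr
  rw [Complex.integral_cpow_mul_exp_neg_mul_Ioi hs hr0, one_div, Complex.cpow_neg,
    Complex.inv_cpow]
  rw [Complex.arg_ofReal_of_nonneg hr0.le]
  exact Real.pi_pos.ne

/-- A product of finitely many absolutely convergent series can be expanded. -/
theorem summable_norm_and_hasSum_prod {n : ℕ} {f : Fin n → ℕ → ℂ} {S : Fin n → ℂ}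
    (hf : ∀ j, Summable fun i => ‖f j i‖) (hS : ∀ j, HasSum (f j) (S j)) :
    (Summable fun m : Fin n → ℕ => ‖∏ j, f j (m j)‖) ∧
      HasSum (fun m : Fin n → ℕ => ∏ j, f j (m j)) (∏ j, S j) := by
  induction n with
  | zero => exact ⟨(hasSum_unique _).summable, by simp⟩
  | succ n ih =>
    obtain ⟨h1, h2⟩ := ih (f := fun j => f j.succ) (fun j => hf j.succ) (fun j => hS j.succ)
    have hmul {g : (Fin n → ℕ) → ℂ} {b : ℂ} (hg : Summable fun m => ‖g m‖) (hb : HasSum g b) :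
        HasSum (fun x : ℕ × (Fin n → ℕ) => f 0 x.1 * g x.2) (S 0 * b) :=
      (hS 0).mul hb (summable_mul_of_summable_norm (hf 0) hg)
    have h4 := hmul h1 h2
    have e (x : ℕ × (Fin n → ℕ)) : ∏ j, f j (Fin.consEquiv (fun _ => ℕ) x j) =
        f 0 x.1 * ∏ j, f j.succ (x.2 j) := by
      simp [Fin.prod_univ_succ, Fin.consEquiv]
    constructor
    · rw [← (Fin.consEquiv fun _ : Fin (n + 1) => ℕ).summable_iff]
      refine ((hf 0).mul_of_nonneg h1 (fun _ => norm_nonneg _) fun _ => norm_nonneg _).congr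
        fun x => ?_
      rw [← norm_mul]
      exact congrArg norm (e x).symm
    · rw [← (Fin.consEquiv fun _ : Fin (n + 1) => ℕ).hasSum_iff, Fin.prod_univ_succ]
      refine h4.congr_fun fun x => ?_
      exact e x

/-- Since the geometric mean of the `1 + m j` is at most `1 + ∑ j, m j`, the series is dominated by
a product of `n` convergent one-variable series. -/
theorem summable_rpow_neg_linear {n : ℕ} {b : ℝ} {r : Fin n → ℝ} (hb : 0 < b)
    (hr : ∀ j, 0 < r j) {σ : ℝ} (hσ : n < σ) :
    Summable fun m : Fin n → ℕ => (b + ∑ j, r j * m j) ^ (-σ) := by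
  rcases Nat.eq_zero_or_pos n with rfl | hn
  · exact (hasSum_unique _).summable
  have hn0 : (0 : ℝ) < n := by exact_mod_cast hn
  have hσ0 : 0 < σ := hn0.trans hσ
  obtain ⟨c, hc0, hcb, hcr⟩ : ∃ c > 0, c ≤ b ∧ ∀ j, c ≤ r j := by
    have : Nonempty (Fin n) := ⟨⟨0, hn⟩⟩
    obtain ⟨i, hi⟩ := Finite.exists_min r
    exact ⟨min b (r i), lt_min hb (hr i), min_le_left _ _,
      fun j => (min_le_right _ _).trans (hi j)⟩
  have h1 : Summable fun i : ℕ => ((1 + i : ℝ)) ^ (-(σ / n)) := by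
    have h2 : Summable fun i : ℕ => ((i : ℝ)) ^ (-(σ / n)) :=
      Real.summable_nat_rpow.2 (by
        have : 1 < σ / n := (one_lt_div hn0).2 hσ
        linarith)
    refine ((summable_nat_add_iff 1).2 h2).congr fun i => ?_
    push_cast
    rw [add_comm]
  have h2 : Summable fun i : ℕ => ‖(((1 + i : ℝ) ^ (-(σ / n)) : ℝ) : ℂ)‖ := by
    refine h1.congr fun i => ?_
    rw [Complex.norm_real, Real.norm_of_nonneg (by positivity)]
  have h3 := (summable_norm_and_hasSum_prod (n := n) (fun _ => h2)
    (fun _ => h2.of_norm.hasSum)).1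
  refine Summable.of_nonneg_of_le (fun m => Real.rpow_nonneg ?_ _) (fun m => ?_)
    (h3.mul_left (c ^ (-σ)))
  · exact add_nonneg hb.le (Finset.sum_nonneg fun j _ => mul_nonneg (hr j).le (Nat.cast_nonneg _))
  · set T : ℝ := 1 + ∑ j, (m j : ℝ) with hT
    have hT0 : 0 < T := by positivity
    have hle : c * T ≤ b + ∑ j, r j * m j := by
      rw [hT, mul_add, mul_one, Finset.mul_sum]
      gcongr with j
      exact hcr j
    have hprod : ∏ j, (1 + m j : ℝ) ^ (σ / n) ≤ T ^ σ := by
      calc ∏ j, (1 + m j : ℝ) ^ (σ / n) ≤ ∏ _j : Fin n, T ^ (σ / n) := by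
            gcongr with j
            rw [hT]
            gcongr
            exact Finset.single_le_sum (f := fun j => (m j : ℝ)) (fun i _ => Nat.cast_nonneg _)
              (Finset.mem_univ j)
        _ = T ^ σ := by
            rw [Finset.prod_const, Finset.card_univ, Fintype.card_fin, ← Real.rpow_natCast,
              ← Real.rpow_mul hT0.le, div_mul_cancel₀ _ hn0.ne']
    have hpos : 0 < ∏ j, (1 + m j : ℝ) ^ (σ / n) := Finset.prod_pos fun j _ => by positivity
    calc (b + ∑ j, r j * m j) ^ (-σ) ≤ (c * T) ^ (-σ) :=
          Real.rpow_le_rpow_of_nonpos (by positivity) hle (by linarith)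
      _ = c ^ (-σ) * (T ^ σ)⁻¹ := by
          rw [Real.mul_rpow hc0.le hT0.le, Real.rpow_neg hT0.le]
      _ ≤ c ^ (-σ) * (∏ j, (1 + m j : ℝ) ^ (σ / n))⁻¹ := by gcongr
      _ = _ := by
          rw [norm_prod, ← Finset.prod_inv_distrib]
          congr 1
          refine Finset.prod_congr rfl fun j _ => ?_
          rw [Complex.norm_real, Real.norm_of_nonneg (by positivity), Real.rpow_neg (by positivity)]

theorem hasSum_bernoulliKernel {y : ℝ} {z : ℂ} (hz : 0 < z.re) :
    (Summable fun i : ℕ => ‖exp (-(z * (1 - y))) * exp (-z) ^ i‖) ∧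
      HasSum (fun i : ℕ => exp (-(z * (1 - y))) * exp (-z) ^ i) (bernoulliKernel y z) := by
  have h1 : ‖exp (-z)‖ < 1 := by
    rw [Complex.norm_exp, Real.exp_lt_one_iff, Complex.neg_re]
    linarith
  constructor
  · simp only [norm_mul, norm_pow]
    exact (summable_geometric_of_lt_one (norm_nonneg _) h1).mul_left _
  · have h2 := (hasSum_geometric_of_norm_lt_one h1).mul_left (exp (-(z * (1 - y))))
    have h3 : bernoulliKernel y z = exp (-(z * (1 - y))) * (1 - exp (-z))⁻¹ := by
      have hne : 1 - exp (-z) ≠ 0 := by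
        intro h0
        rw [← sub_eq_zero.1 h0, norm_one] at h1
        exact lt_irrefl _ h1
      have e1 : exp (-(z * (1 - y))) = exp (z * y) * exp (-z) := by
        rw [← Complex.exp_add]; ring_nf
      have e2 : exp z - 1 = (1 - exp (-z)) * exp z := by
        rw [sub_mul, one_mul, ← Complex.exp_add]; simp
      have e3 : exp (-z) * exp z = 1 := by rw [← Complex.exp_add]; simp
      have e4 := Complex.exp_ne_zero z
      rw [bernoulliKernel, e1, e2, div_eq_iff (mul_ne_zero hne e4)]
      field_simp
      exact e3.symm
    rwa [h3]

/-- For `Re ω j > 0` the kernel is the exponential series belonging to the frequencies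
`a(y) + ∑ ω j * m j` of the Barnes zeta function. -/
theorem hasSum_barnesKernel {n : ℕ} {ω : Fin n → ℂ} (hω : ∀ j, 0 < (ω j).re) (y : ℝ) {t : ℝ}
    (ht : 0 < t) :
    HasSum (fun m : Fin n → ℕ => exp (-((barnesShift ω y + ∑ j, ω j * (m j : ℂ)) * t)))
      (barnesKernel ω y t) := by
  have hre (j) : 0 < (ω j * (t : ℂ)).re := by
    rw [Complex.re_mul_ofReal]; exact mul_pos (hω j) ht
  have h := (summable_norm_and_hasSum_prod
    (fun j => (hasSum_bernoulliKernel (y := y) (hre j)).1)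
    (fun j => (hasSum_bernoulliKernel (y := y) (hre j)).2)).2
  refine h.congr_fun fun m => ?_
  rw [barnesShift, ← Finset.sum_add_distrib, Finset.sum_mul, ← Finset.sum_neg_distrib,
    Complex.exp_sum]
  refine Finset.prod_congr rfl fun j _ => ?_
  rw [← Complex.exp_nat_mul, ← Complex.exp_add]
  ring_nf

theorem re_barnesShift_pos {n : ℕ} (hn : 0 < n) {ω : Fin n → ℂ} (hω : ∀ j, 0 < (ω j).re) {y : ℝ}
    (hy1 : y < 1) : 0 < (barnesShift ω y).re := by
  rw [barnesShift, Complex.re_sum]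
  have : Nonempty (Fin n) := ⟨⟨0, hn⟩⟩
  refine Finset.sum_pos (fun j _ => ?_) Finset.univ_nonempty
  have : (ω j * (1 - (y : ℂ))).re = (ω j).re * (1 - y) := by simp
  rw [this]
  exact mul_pos (hω j) (by linarith)

/-- In the half plane of convergence the Dirichlet series is the Mellin transform of the kernel. -/
theorem hasSum_mellin_barnesKernel {n : ℕ} (hn : 0 < n) {ω : Fin n → ℂ} (hω : ∀ j, 0 < (ω j).re)
    {y : ℝ} (hy1 : y < 1) {s : ℂ} (hs : n < s.re) :
    HasSum (fun m : Fin n → ℕ => (barnesShift ω y + ∑ j, ω j * (m j : ℂ)) ^ (-s) * Gamma s)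
      (mellin (fun t : ℝ => barnesKernel ω y t) s) := by
  have hs0 : 0 < s.re := lt_of_le_of_lt (Nat.cast_nonneg n) hs
  have ha := re_barnesShift_pos hn hω hy1
  have hre (m : Fin n → ℕ) : (barnesShift ω y + ∑ j, ω j * (m j : ℂ)).re =
      (barnesShift ω y).re + ∑ j, (ω j).re * m j := by simp
  have hpos (m : Fin n → ℕ) : 0 < (barnesShift ω y + ∑ j, ω j * (m j : ℂ)).re := by
    rw [hre]
    exact add_pos_of_pos_of_nonneg ha
      (Finset.sum_nonneg fun j _ => mul_nonneg (hω j).le (Nat.cast_nonneg _))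
  have hs1 : (s - 1).re = s.re - 1 := by simp
  have h := hasSum_integral_of_summable_integral_norm (μ := volume.restrict (Set.Ioi (0 : ℝ)))
    (F := fun (m : Fin n → ℕ) (t : ℝ) => (t : ℂ) ^ (s - 1) *
      exp (-((barnesShift ω y + ∑ j, ω j * (m j : ℂ)) * t)))
    (fun m => integrableOn_cpow_mul_exp_neg (by rw [hs1]; linarith) (hpos m)) (by
      refine ((summable_rpow_neg_linear ha hω hs).mul_right (Real.Gamma s.re)).congr fun m => ?_
      rw [setIntegral_congr_fun measurableSet_Ioi fun t ht => norm_cpow_mul_exp_neg ht _ _, hs1,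
        Real.integral_rpow_mul_exp_neg_mul_Ioi hs0 (hpos m), one_div, Real.inv_rpow (hpos m).le,
        ← Real.rpow_neg (hpos m).le, hre])
  have h2 : mellin (fun t : ℝ => barnesKernel ω y t) s =
      ∫ t in Set.Ioi (0 : ℝ), ∑' m : Fin n → ℕ, (t : ℂ) ^ (s - 1) *
        exp (-((barnesShift ω y + ∑ j, ω j * (m j : ℂ)) * t)) := by
    rw [mellin]
    refine setIntegral_congr_fun measurableSet_Ioi fun t ht => ?_
    simp only [smul_eq_mul]
    rw [tsum_mul_left, (hasSum_barnesKernel hω y ht).tsum_eq]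
  rw [h2]
  refine h.congr_fun fun m => ?_
  rw [integral_cpow_mul_exp_neg hs0 (hpos m)]

end DirichletSeries

/-! ### Analytic continuation of Mellin transforms -/

section MellinContinuation

open MeasureTheory

/-- `K t` with the first `N` terms of its expansion `∑ c i * t ^ (i - n)` at `0` removed on
`(0, 1]`. -/
noncomputable def mellinRemainder (K : ℝ → ℂ) (c : ℕ → ℂ) (n N : ℕ) (t : ℝ) : ℂ :=
  K t - ∑ i ∈ Finset.range N,
    c i * (Set.Ioc (0 : ℝ) 1).indicator (fun t : ℝ => (t : ℂ) ^ ((i : ℂ) - n)) t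

/-- The continuation of the Mellin transform of `K` to `Re s > n - N`: the removed terms of the
expansion contribute simple fractions. -/
noncomputable def mellinExtension (K : ℝ → ℂ) (c : ℕ → ℂ) (n N : ℕ) (s : ℂ) : ℂ :=
  mellin (mellinRemainder K c n N) s + ∑ i ∈ Finset.range N, c i * (1 / (s + ((i : ℂ) - n)))

variable {K : ℝ → ℂ} {c : ℕ → ℂ} {n : ℕ} {a : ℝ}

theorem locallyIntegrableOn_mellinRemainder (hK : ContinuousOn K (Set.Ioi 0)) (N : ℕ) :
    LocallyIntegrableOn (mellinRemainder K c n N) (Set.Ioi 0) := by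
  rw [locallyIntegrableOn_iff isOpen_Ioi.isLocallyClosed]
  intro k hk hkc
  refine Integrable.sub ((hK.mono hk).integrableOn_compact hkc) ?_
  refine integrable_finsetSum _ fun i _ => Integrable.const_mul ?_ _
  refine Integrable.indicator (ContinuousOn.integrableOn_compact hkc ?_) measurableSet_Ioc
  intro t ht
  have : (t : ℂ) ∈ slitPlane := Complex.ofReal_mem_slitPlane.2 (hk ht)
  exact (ContinuousAt.cpow (by fun_prop) (by fun_prop) this).continuousWithinAt

theorem mellinRemainder_isBigO_atTop (hexp : K =O[atTop] fun t => Real.exp (-a * t)) (N : ℕ) :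
    mellinRemainder K c n N =O[atTop] fun t => Real.exp (-a * t) := by
  refine hexp.congr' ?_ EventuallyEq.rfl
  filter_upwards [eventually_gt_atTop 1] with t ht
  rw [mellinRemainder, Finset.sum_eq_zero, sub_zero]
  intro i _
  rw [Set.indicator_of_notMem (fun h => absurd h.2 (not_le.2 ht)), mul_zero]

theorem mellinRemainder_isBigO_zero
    (h0 : ∀ N : ℕ, (fun t : ℝ => (t : ℂ) ^ n * K t - ∑ i ∈ Finset.range N, c i * (t : ℂ) ^ i)
      =O[𝓝[>] 0] fun t : ℝ => (t : ℂ) ^ N) (N : ℕ) :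
    mellinRemainder K c n N =O[𝓝[>] 0] fun t => t ^ (-((n : ℝ) - N)) := by
  have h := (h0 N).mul (Asymptotics.isBigO_refl (fun t : ℝ => ((t : ℂ) ^ n)⁻¹) (𝓝[>] 0))
  refine (h.congr' ?_ EventuallyEq.rfl).trans (Asymptotics.IsBigO.of_bound 1 ?_)
  · filter_upwards [Ioc_mem_nhdsGT one_pos] with t ht
    have ht0 : (t : ℂ) ≠ 0 := Complex.ofReal_ne_zero.2 ht.1.ne'
    rw [mellinRemainder, sub_mul, mul_comm ((t : ℂ) ^ n), mul_assoc,
      mul_inv_cancel₀ (pow_ne_zero n ht0), mul_one, Finset.sum_mul]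
    congr 1
    refine Finset.sum_congr rfl fun i _ => ?_
    rw [Set.indicator_of_mem ht, Complex.cpow_sub _ _ ht0, Complex.cpow_natCast,
      Complex.cpow_natCast]
    ring
  · filter_upwards [self_mem_nhdsWithin] with t ht
    have ht : 0 < t := ht
    rw [one_mul, norm_mul, norm_inv, norm_pow, norm_pow, Complex.norm_real,
      Real.norm_of_nonneg ht.le, Real.norm_of_nonneg (by positivity), neg_sub,
      Real.rpow_sub ht, Real.rpow_natCast, Real.rpow_natCast, div_eq_mul_inv]

variable (hK : ContinuousOn K (Set.Ioi 0)) (ha : 0 < a)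
  (hexp : K =O[atTop] fun t => Real.exp (-a * t))
  (h0 : ∀ N : ℕ, (fun t : ℝ => (t : ℂ) ^ n * K t - ∑ i ∈ Finset.range N, c i * (t : ℂ) ^ i)
    =O[𝓝[>] 0] fun t : ℝ => (t : ℂ) ^ N)

include hK ha hexp h0

theorem mellinConvergent_mellinRemainder {N : ℕ} {s : ℂ} (hs : (n : ℝ) - N < s.re) :
    MellinConvergent (mellinRemainder K c n N) s :=
  mellinConvergent_of_isBigO_rpow_exp ha (locallyIntegrableOn_mellinRemainder hK N)
    (mellinRemainder_isBigO_atTop hexp N) (mellinRemainder_isBigO_zero h0 N) hs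

theorem analyticAt_mellin_mellinRemainder {N : ℕ} {s : ℂ} (hs : (n : ℝ) - N < s.re) :
    AnalyticAt ℂ (mellin (mellinRemainder K c n N)) s := by
  have hopen : IsOpen {s : ℂ | (n : ℝ) - N < s.re} := isOpen_lt continuous_const continuous_re
  refine DifferentiableOn.analyticAt (s := {s : ℂ | (n : ℝ) - N < s.re}) (fun z hz => ?_)
    (hopen.mem_nhds hs)
  exact (mellin_differentiableAt_of_isBigO_rpow_exp ha (locallyIntegrableOn_mellinRemainder hK N)
    (mellinRemainder_isBigO_atTop hexp N) (mellinRemainder_isBigO_zero h0 N)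
    hz).differentiableWithinAt

theorem mellinExtension_succ {N : ℕ} {s : ℂ} (hs : (n : ℝ) - N < s.re) :
    mellinExtension K c n (N + 1) s = mellinExtension K c n N s := by
  have h1 := mellinConvergent_mellinRemainder (c := c) (N := N + 1) hK ha hexp h0 (s := s) (by
    push_cast; linarith)
  obtain ⟨h2, h3⟩ := hasMellin_cpow_Ioc ((N : ℂ) - n) (s := s) (by simp; linarith)
  have h4 := (hasMellin_add h1 (h2.const_smul (c N))).2
  rw [mellin_const_smul, h3] at h4
  have h5 : (fun t => mellinRemainder K c n (N + 1) t +
      c N • (Set.Ioc (0 : ℝ) 1).indicator (fun t : ℝ => (t : ℂ) ^ ((N : ℂ) - n)) t) =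
        mellinRemainder K c n N := by
    funext t
    simp only [mellinRemainder, Finset.sum_range_succ, smul_eq_mul]
    ring
  rw [h5] at h4
  rw [mellinExtension, mellinExtension, h4, Finset.sum_range_succ, smul_eq_mul]
  ring

theorem mellinExtension_eq_of_le {N N' : ℕ} (h : N ≤ N') {s : ℂ} (hs : (n : ℝ) - N < s.re) :
    mellinExtension K c n N' s = mellinExtension K c n N s := by
  induction N', h using Nat.le_induction with
  | base => rfl
  | succ M hM ih =>
    have : (N : ℝ) ≤ M := by exact_mod_cast hM
    rw [mellinExtension_succ hK ha hexp h0 (by linarith), ih]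

/-- If `K` decays exponentially and `K t ~ ∑ c i * t ^ (i - n)` as `t → 0+`, its Mellin transform
extends to a function `F` on the plane that has at most simple poles, at the points `n - i`, and
`F` has residue `c i` at `n - i`. -/
theorem exists_mellin_continuation :
    ∃ F : ℂ → ℂ, (∀ s : ℂ, (n : ℝ) < s.re → F s = mellin K s) ∧
      ∀ (s₀ : ℂ) (N : ℕ), (n : ℝ) - N < s₀.re → ∃ g : ℂ → ℂ, AnalyticAt ℂ g s₀ ∧
        ∀ᶠ s in 𝓝 s₀, F s = g s + ∑ i ∈ Finset.range N, c i * (1 / (s + ((i : ℂ) - n))) := by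
  -- the extensions for different `N` agree, so any `N > n - Re s` may be used at `s`
  let M : ℂ → ℕ := fun s => ⌈(n : ℝ) - s.re⌉₊ + 1
  have hM (s : ℂ) : (n : ℝ) - M s < s.re := by
    have := Nat.le_ceil ((n : ℝ) - s.re)
    simp only [M, Nat.cast_add, Nat.cast_one]
    linarith
  have key (s : ℂ) (N : ℕ) (hs : (n : ℝ) - N < s.re) :
      mellinExtension K c n (M s) s = mellinExtension K c n N s := by
    rcases le_total (M s) N with h | h
    · exact (mellinExtension_eq_of_le hK ha hexp h0 h (hM s)).symm
    · exact mellinExtension_eq_of_le hK ha hexp h0 h hs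
  refine ⟨fun s => mellinExtension K c n (M s) s, fun s hs => ?_, fun s₀ N hN => ?_⟩
  · have h1 : mellinRemainder K c n 0 = K := by
      funext t
      simp [mellinRemainder]
    change mellinExtension K c n (M s) s = mellin K s
    rw [key s 0 (by simpa using hs), mellinExtension, h1, Finset.sum_range_zero, add_zero]
  · refine ⟨_, analyticAt_mellin_mellinRemainder (c := c) hK ha hexp h0 hN, ?_⟩
    have hopen : IsOpen {s : ℂ | (n : ℝ) - N < s.re} := isOpen_lt continuous_const continuous_re
    filter_upwards [hopen.mem_nhds hN] with s hs
    exact key s N hs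

end MellinContinuation

theorem barnesKernel_continuousOn {n : ℕ} {ω : Fin n → ℂ} (hω : ∀ j, 0 < (ω j).re) (y : ℝ) :
    ContinuousOn (fun t : ℝ => barnesKernel ω y t) (Set.Ioi 0) := by
  intro t ht
  have ht : 0 < t := ht
  refine ((differentiableAt_barnesKernel fun j h => ?_).continuousAt.comp
    continuous_ofReal.continuousAt).continuousWithinAt
  have h1 := congrArg norm h
  rw [Complex.norm_exp, norm_one, Real.exp_eq_one_iff, Complex.re_mul_ofReal] at h1
  exact (mul_pos (hω j) ht).ne' h1

theorem barnesKernel_isBigO_atTop {n : ℕ} {ω : Fin n → ℂ} (hω : ∀ j, 0 < (ω j).re) (y : ℝ) :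
    (fun t : ℝ => barnesKernel ω y t) =O[atTop]
      fun t : ℝ => Real.exp (-(barnesShift ω y).re * t) := by
  have h1 (j : Fin n) : (fun t : ℝ => bernoulliKernel y (ω j * t)) =O[atTop]
      fun t : ℝ => Real.exp (-((ω j).re * (1 - y)) * t) := by
    refine Asymptotics.IsBigO.of_bound 2 ?_
    have ht : Tendsto (fun t : ℝ => (ω j).re * t) atTop atTop :=
      tendsto_id.const_mul_atTop (hω j)
    filter_upwards [ht.eventually_ge_atTop 1] with t ht
    have h2 : Real.exp ((ω j).re * t) - 1 ≤ ‖exp (ω j * t) - 1‖ := by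
      have := norm_sub_norm_le (exp (ω j * t)) 1
      rwa [Complex.norm_exp, norm_one, Complex.re_mul_ofReal] at this
    have h3 : 2 ≤ Real.exp ((ω j).re * t) := by linarith [Real.add_one_le_exp ((ω j).re * t)]
    have h4 : ‖exp (ω j * t * y)‖ = Real.exp ((ω j).re * t * y) := by
      rw [Complex.norm_exp, Complex.re_mul_ofReal, Complex.re_mul_ofReal]
    have h5 : Real.exp ((ω j).re * t * y) =
        Real.exp (-((ω j).re * (1 - y)) * t) * Real.exp ((ω j).re * t) := by
      rw [← Real.exp_add]; ring_nf
    rw [bernoulliKernel, norm_div, h4, div_le_iff₀ (by linarith),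
      Real.norm_of_nonneg (Real.exp_pos _).le, h5]
    nlinarith [Real.exp_pos (-((ω j).re * (1 - y)) * t)]
  refine (Asymptotics.IsBigO.finsetProd (s := Finset.univ) fun j _ => h1 j).congr_right fun t => ?_
  rw [← Real.exp_sum, barnesShift, Complex.re_sum, ← Finset.sum_neg_distrib, Finset.sum_mul]
  congr 1
  refine Finset.sum_congr rfl fun j _ => ?_
  simp

/-- The Mellin transform of the kernel extends to the plane, with principal part
`bernoulliSum ω y l / (s - (n - l))` at `n - l`. -/
theorem exists_barnesKernel_continuation {n : ℕ} (hn : 0 < n) {ω : Fin n → ℂ}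
    (hω : ∀ j, 0 < (ω j).re) {y : ℝ} (hy1 : y < 1) :
    ∃ F : ℂ → ℂ, (∀ s : ℂ, (n : ℝ) < s.re →
        F s = mellin (fun t : ℝ => barnesKernel ω y t) s ∧ AnalyticAt ℂ F s) ∧
      (∀ s, MeromorphicAt F s) ∧
      ∀ l : ℤ, ∃ g : ℂ → ℂ, AnalyticAt ℂ g ((n : ℂ) - l) ∧
        ∀ᶠ s in 𝓝[≠] ((n : ℂ) - l), F s = g s + bernoulliSum ω y l * (s - (n - l))⁻¹ := by
  have hω0 (j) : ω j ≠ 0 := by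
    intro h
    have := hω j
    rw [h, Complex.zero_re] at this
    exact lt_irrefl _ this
  have ht : Tendsto (fun t : ℝ => (t : ℂ)) (𝓝[>] 0) (𝓝[≠] 0) := by
    refine tendsto_nhdsWithin_iff.2 ⟨?_, ?_⟩
    · exact (continuous_ofReal.tendsto' 0 0 (by simp)).mono_left nhdsWithin_le_nhds
    · filter_upwards [self_mem_nhdsWithin] with t ht
      exact Complex.ofReal_ne_zero.2 (ne_of_gt ht)
  obtain ⟨F, hF, hF'⟩ := exists_mellin_continuation (c := fun i => bernoulliSum ω y i)
    (barnesKernel_continuousOn hω y) (re_barnesShift_pos hn hω hy1) (barnesKernel_isBigO_atTop hω y)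
    fun N => (barnesKernel_sub_isBigO hω0 y N).comp_tendsto ht
  refine ⟨F, fun s hs => ⟨hF s hs, ?_⟩, fun s => ?_, fun l => ?_⟩
  · obtain ⟨g, hg, hFg⟩ := hF' s 0 (by simpa using hs)
    refine hg.congr ?_
    filter_upwards [hFg] with z hz
    simp [hz]
  · obtain ⟨N, hN⟩ := exists_nat_gt ((n : ℝ) - s.re)
    obtain ⟨g, hg, hFg⟩ := hF' s N (by linarith)
    refine MeromorphicAt.congr (f := fun s => g s +
      ∑ i ∈ Finset.range N, bernoulliSum ω y i * (1 / (s + ((i : ℂ) - n)))) ?_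
      (Filter.EventuallyEq.filter_mono (hFg.mono fun _ h => h.symm) nhdsWithin_le_nhds)
    refine hg.meromorphicAt.fun_add (MeromorphicAt.fun_sum fun i _ => ?_)
    exact (MeromorphicAt.const _ _).fun_mul ((MeromorphicAt.const _ _).fun_div
      ((MeromorphicAt.id _).fun_add (MeromorphicAt.const _ _)))
  · obtain ⟨g, hg, hFg⟩ := hF' ((n : ℂ) - l) (l + 1).toNat (by
      have h1 : ((l : ℝ) + 1) ≤ ((l + 1).toNat : ℝ) := by exact_mod_cast Int.self_le_toNat (l + 1)
      simp
      linarith)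
    -- the fractions with poles elsewhere are analytic at `n - l`
    refine ⟨fun s => g s + ∑ i ∈ (Finset.range (l + 1).toNat).filter (fun i : ℕ => (i : ℤ) ≠ l),
      bernoulliSum ω y i * (1 / (s + ((i : ℂ) - n))), ?_, ?_⟩
    · refine hg.fun_add (Finset.analyticAt_fun_sum _ fun i hi => ?_)
      refine analyticAt_const.fun_mul (analyticAt_const.fun_div (by fun_prop) ?_)
      have hil : (i : ℤ) ≠ l := (Finset.mem_filter.1 hi).2
      intro h
      apply hil
      have : (i : ℂ) = l := by linear_combination h
      exact_mod_cast this
    · filter_upwards [hFg.filter_mono nhdsWithin_le_nhds] with s hs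
      rw [hs, add_assoc]
      congr 1
      rw [← Finset.sum_filter_add_sum_filter_not (Finset.range (l + 1).toNat)
        (fun i : ℕ => (i : ℤ) ≠ l)]
      congr 1
      simp only [not_not]
      rcases lt_or_ge l 0 with hl | hl
      · rw [Int.toNat_of_nonpos (by omega), bernoulliSum, if_neg (by omega)]
        simp
      · lift l to ℕ using hl
        have : (Finset.range ((l : ℤ) + 1).toNat).filter (fun i : ℕ => (i : ℤ) = l) = {l} := by
          ext i
          simp only [Finset.mem_filter, Finset.mem_range, Finset.mem_singleton]
          omega
        rw [this, Finset.sum_singleton, one_div]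
        congr 2
        push_cast
        ring

/-! ### The Barnes zeta function and its special values -/

/-- The zero of `1 / Γ` at `-k` is simple, with derivative `(-1) ^ k * k!`. -/
theorem tendsto_Gamma_inv_div (k : ℕ) :
    Tendsto (fun s : ℂ => (Gamma s)⁻¹ * (s + k)⁻¹) (𝓝[≠] (-(k : ℂ)))
      (𝓝 ((-1) ^ k * (k.factorial : ℂ))) := by
  induction k with
  | zero =>
    have h := Complex.tendsto_self_mul_Gamma_nhds_zero.inv₀ one_ne_zero
    simp only [Nat.cast_zero, neg_zero, add_zero, pow_zero, Nat.factorial_zero, Nat.cast_one,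
      mul_one]
    rw [inv_one] at h
    refine h.congr fun s => ?_
    rw [mul_inv, mul_comm]
  | succ k ih =>
    have ht : Tendsto (fun s : ℂ => s + 1) (𝓝[≠] (-((k + 1 : ℕ) : ℂ))) (𝓝[≠] (-(k : ℂ))) := by
      refine tendsto_nhdsWithin_iff.2 ⟨?_, ?_⟩
      · exact ((continuous_add_const (1 : ℂ)).tendsto' _ _ (by push_cast; ring)).mono_left
          nhdsWithin_le_nhds
      · filter_upwards [self_mem_nhdsWithin] with s hs h
        refine hs ?_
        have h1 : s + 1 = -(k : ℂ) := h
        change s = _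
        push_cast
        linear_combination h1
    have h1 : Tendsto (fun s : ℂ => s) (𝓝[≠] (-((k + 1 : ℕ) : ℂ))) (𝓝 (-((k + 1 : ℕ) : ℂ))) :=
      tendsto_id.mono_left nhdsWithin_le_nhds
    have h2 := h1.mul (ih.comp ht)
    have h3 : -((k + 1 : ℕ) : ℂ) * ((-1) ^ k * (k.factorial : ℂ)) =
        (-1) ^ (k + 1) * ((k + 1).factorial : ℂ) := by
      rw [Nat.factorial_succ]
      push_cast
      ring
    rw [h3] at h2
    refine h2.congr fun s => ?_
    rw [Complex.one_div_Gamma_eq_self_mul_one_div_Gamma_add_one s, Function.comp_apply]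
    push_cast
    rw [add_assoc s 1, add_comm (1 : ℂ), mul_assoc]

/-- The residue at a simple pole. -/
theorem residueAt_eq_of_eventually {f h : ℂ → ℂ} {c : ℂ} (hh : AnalyticAt ℂ h c)
    (hf : ∀ᶠ z in 𝓝[≠] c, f z = (z - c)⁻¹ * h z) : residueAt f c = h c := by
  obtain ⟨ε, hε, hball⟩ : ∃ ε > 0, ∀ z ∈ Metric.ball c ε,
      DifferentiableAt ℂ h z ∧ (z ≠ c → f z = (z - c)⁻¹ * h z) := by
    have h1 : ∀ᶠ z in 𝓝 c, DifferentiableAt ℂ h z :=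
      hh.eventually_analyticAt.mono fun z hz => hz.differentiableAt
    exact Metric.eventually_nhds_iff_ball.1 (h1.and (eventually_nhdsWithin_iff.1 hf))
  refine Tendsto.limUnder_eq (tendsto_const_nhds.congr' ?_)
  filter_upwards [Ioo_mem_nhdsGT hε] with r hr
  have hsub : Metric.closedBall c r ⊆ Metric.ball c ε := Metric.closedBall_subset_ball hr.2
  have hd : DiffContOnCl ℂ h (Metric.ball c r) := by
    refine DifferentiableOn.diffContOnCl fun z hz => ?_
    rw [closure_ball c hr.1.ne'] at hz
    exact (hball z (hsub hz)).1.differentiableWithinAt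
  have h2 := hd.circleIntegral_sub_inv_smul (Metric.mem_ball_self hr.1)
  have h3 : ∮ z in C(c, r), f z = ∮ z in C(c, r), (z - c)⁻¹ • h z := by
    refine circleIntegral.integral_congr hr.1.le fun z hz => ?_
    refine (hball z (hsub (Metric.sphere_subset_closedBall hz))).2 ?_
    rintro rfl
    simp only [Metric.mem_sphere, dist_self] at hz
    exact hr.1.ne hz
  rw [h3, h2, smul_eq_mul, inv_mul_cancel_left₀ Complex.two_pi_I_ne_zero]

/-- `bernoulliSum ω y l` is homogeneous of degree `l - n` in `ω`. -/
theorem bernoulliSum_mul_right {n : ℕ} (ω : Fin n → ℂ) (y : ℝ) (l : ℤ) {ε : ℂ} (hε : ε ≠ 0) :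
    bernoulliSum (fun j => ω j * ε) y l = ε ^ (l - n) * bernoulliSum ω y l := by
  rcases lt_or_ge l 0 with hl | hl
  · simp [bernoulliSum, not_le.2 hl]
  · simp only [bernoulliSum, if_pos hl]
    rw [Finset.mul_sum]
    refine Finset.sum_congr rfl fun m hm => ?_
    have hsum : ∑ j, ((m j : ℤ) - 1) = l - n := by
      have h1 := (Finset.mem_piAntidiag.1 hm).1
      rw [Finset.sum_sub_distrib, ← Nat.cast_sum, h1, Int.toNat_of_nonneg hl]
      simp
    have hpow : ∏ j, ε ^ ((m j : ℤ) - 1) = ε ^ (l - n) := by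
      rw [← hsum]
      induction (Finset.univ : Finset (Fin n)) using Finset.induction_on with
      | empty => simp
      | insert a s ha ih => rw [Finset.prod_insert ha, Finset.sum_insert ha, zpow_add₀ hε, ih]
    rw [← hpow, ← Finset.prod_mul_distrib]
    refine Finset.prod_congr rfl fun j _ => ?_
    rw [mul_zpow]
    ring

/-- The Barnes zeta function exists, and near `n - l` it is `1 / Γ(s)` times a function with
principal part `bernoulliSum ω y l / (s - (n - l))`, up to an exponential factor coming from the
rotation of the frequencies into the right half plane. -/
theorem exists_isBarnesZeta {n : ℕ} (hn : 0 < n) {θ : ℝ} {ω : Fin n → ℂ}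
    (hω : ∀ j, ω j ∈ halfPlane θ) {y : ℝ} (hy1 : y < 1) :
    ∃ Z, IsBarnesZeta θ (barnesShift ω y) ω Z ∧
      ∀ l : ℤ, ∃ g h : ℂ → ℂ, AnalyticAt ℂ g ((n : ℂ) - l) ∧ AnalyticAt ℂ h ((n : ℂ) - l) ∧
        h ((n : ℂ) - l) = bernoulliSum ω y l ∧
        ∀ᶠ s in 𝓝[≠] ((n : ℂ) - l), Z s = (Gamma s)⁻¹ * (g s + h s * (s - (n - l))⁻¹) := by
  set ε : ℂ := exp (-(θ * I)) with hε
  have hε0 : ε ≠ 0 := Complex.exp_ne_zero _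
  set w : Fin n → ℂ := fun j => ω j * ε with hw
  have hw0 (j) : 0 < (w j).re := hω j
  obtain ⟨F, hF, hFm, hFl⟩ := exists_barnesKernel_continuation hn hw0 hy1
  have hshift : barnesShift w y = barnesShift ω y * ε := by
    simp only [barnesShift, hw, Finset.sum_mul]
    exact Finset.sum_congr rfl fun j _ => by ring
  have hGa (s : ℂ) : AnalyticAt ℂ (fun s => (Gamma s)⁻¹) s :=
    Complex.analyticAt_iff_eventually_differentiableAt.2
      (Eventually.of_forall fun z => Complex.differentiable_one_div_Gamma z)
  have hEa (s : ℂ) : AnalyticAt ℂ (fun s : ℂ => exp (-(s * (θ * I)))) s := by fun_prop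
  set Z₀ : ℂ → ℂ := fun s => exp (-(s * (θ * I))) * ((Gamma s)⁻¹ * F s) with hZ₀
  have hZm : MeromorphicOn Z₀ Set.univ := fun s _ =>
    (hEa s).meromorphicAt.fun_mul ((hGa s).meromorphicAt.fun_mul (hFm s))
  refine ⟨toMeromorphicNFOn Z₀ Set.univ, ⟨meromorphicNFOn_toMeromorphicNFOn _ _, fun s hs => ?_⟩,
    fun l => ?_⟩
  · have hZa : AnalyticAt ℂ Z₀ s := (hEa s).fun_mul ((hGa s).fun_mul (hF s hs).2)
    have hval : toMeromorphicNFOn Z₀ Set.univ s = Z₀ s :=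
      (((meromorphicNFOn_toMeromorphicNFOn Z₀ Set.univ
        (Set.mem_univ s)).eventuallyEq_nhdsNE_iff_eventuallyEq_nhds hZa.meromorphicNFAt).1
        (hZm.toMeromorphicNFOn_eq_self_on_nhdsNE (Set.mem_univ s))).eq_of_nhds
    have hs0 : 0 < s.re := lt_of_le_of_lt (Nat.cast_nonneg n) hs
    have hG : Gamma s ≠ 0 := Complex.Gamma_ne_zero_of_re_pos hs0
    have h1 := (hasSum_mellin_barnesKernel hn hw0 hy1 hs).mul_left
      (exp (-(s * (θ * I))) * (Gamma s)⁻¹)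
    rw [hval]
    simp only [hZ₀]
    rw [(hF s hs).1, ← mul_assoc]
    refine h1.congr_fun fun m => ?_
    set x : ℂ := barnesShift ω y + ∑ j, ω j * (m j : ℂ) with hx
    have hxw : barnesShift w y + ∑ j, w j * (m j : ℂ) = x * ε := by
      rw [hshift, hx, add_mul, Finset.sum_mul]
      congr 1
      exact Finset.sum_congr rfl fun j _ => by simp only [hw]; ring
    have hx0 : x * ε ≠ 0 := by
      intro h0
      have h2 : 0 < (barnesShift w y + ∑ j, w j * (m j : ℂ)).re := by
        rw [Complex.add_re, Complex.re_sum]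
        refine add_pos_of_pos_of_nonneg (re_barnesShift_pos hn hw0 hy1)
          (Finset.sum_nonneg fun j _ => ?_)
        rw [← Complex.ofReal_natCast, Complex.re_mul_ofReal]
        exact mul_nonneg (hw0 j).le (Nat.cast_nonneg _)
      rw [hxw, h0, Complex.zero_re] at h2
      exact lt_irrefl _ h2
    rw [hxw, Complex.cpow_def_of_ne_zero hx0, halfPlanePow]
    have e1 : -s * (log (x * exp (-(θ * I))) + θ * I) =
        -(s * (θ * I)) + log (x * ε) * -s := by rw [← hε]; ring
    rw [e1, Complex.exp_add]
    field_simp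
  · obtain ⟨g, hg, hFg⟩ := hFl l
    set s₀ : ℂ := (n : ℂ) - l with hs₀
    refine ⟨fun s => exp (-(s * (θ * I))) * g s,
      fun s => exp (-(s * (θ * I))) * bernoulliSum w y l, (hEa _).fun_mul hg,
      (hEa _).fun_mul analyticAt_const, ?_, ?_⟩
    · simp only [hw, bernoulliSum_mul_right ω y l hε0]
      rw [← mul_assoc, hε, ← Complex.exp_int_mul, ← Complex.exp_add]
      have : -(s₀ * (θ * I)) + ((l - n : ℤ) : ℂ) * -(θ * I) = 0 := by
        rw [hs₀]
        push_cast
        ring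
      rw [this, Complex.exp_zero, one_mul]
    · filter_upwards [hZm.toMeromorphicNFOn_eq_self_on_nhdsNE (Set.mem_univ s₀), hFg] with s h1 h2
      rw [h1]
      simp only [hZ₀]
      rw [h2]
      ring

theorem corollary2p3 (n : ℕ) (hn : 2 ≤ n) (θ : ℝ) (ω : Fin n → ℂ)
    (hω : ∀ j, ω j ∈ halfPlane θ)
    (hIm : ∀ j k, j ≠ k → (ω j / ω k).im ≠ 0)
    (y : ℝ) (hy0 : 0 ≤ y) (hy1 : y < 1) :
    IsBarnesZeta θ (barnesShift ω y) ω (barnesZeta θ (barnesShift ω y) ω) ∧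
    ∀ l : ℤ, (y = 0 → (n : ℤ) < l) →
      (∀ k, Summable fun m : {m : ℤ // m ≠ 0} => barnesTerm ω y l k m) ∧
      ((n : ℤ) ≤ l →
        AnalyticAt ℂ (barnesZeta θ (barnesShift ω y) ω) ((n : ℂ) - l) ∧
        ∑ k, ∑' m : {m : ℤ // m ≠ 0}, barnesTerm ω y l k m =
          (-1 : ℂ) ^ (l - n + 1) / ((l - n).toNat.factorial : ℂ) *
            barnesZeta θ (barnesShift ω y) ω ((n : ℂ) - l)) ∧
      (l < (n : ℤ) →
        ∑ k, ∑' m : {m : ℤ // m ≠ 0}, barnesTerm ω y l k m =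
          -((n - l - 1).toNat.factorial : ℂ) *
            residueAt (barnesZeta θ (barnesShift ω y) ω) ((n : ℂ) - l)) ∧
      ∑ k, ∑' m : {m : ℤ // m ≠ 0}, barnesTerm ω y l k m = -bernoulliSum ω y l := by
  have hω0 (j) : ω j ≠ 0 := by
    intro h
    have := hω j
    simp [halfPlane, h] at this
  obtain ⟨Z, hZ, hZl⟩ := exists_isBarnesZeta (by omega : 0 < n) hω hy1
  have hspec : IsBarnesZeta θ (barnesShift ω y) ω (barnesZeta θ (barnesShift ω y) ω) :=
    Classical.epsilon_spec ⟨Z, hZ⟩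
  rw [hspec.unique hZ]
  refine ⟨hZ, fun l hl => ?_⟩
  have hsum := sum_tsum_barnesTerm hn hω0 hIm hy0 hy1 hl
  refine ⟨fun k => summable_barnesTerm hn hIm hy0 hy1 hl k, fun hnl => ?_, fun hnl => ?_, hsum⟩
  · obtain ⟨g, h, hg, hh, hval, hev⟩ := hZl l
    obtain ⟨k, rfl⟩ : ∃ k : ℕ, l = n + k := ⟨(l - n).toNat, by omega⟩
    have hs₀ : (n : ℂ) - ((n + k : ℤ) : ℂ) = -(k : ℂ) := by push_cast; ring
    rw [hs₀] at hg hh hval hev ⊢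
    have hG := tendsto_Gamma_inv_div k
    have hG0 : Tendsto (fun s : ℂ => (Gamma s)⁻¹) (𝓝[≠] (-(k : ℂ))) (𝓝 0) := by
      have h1 := (Complex.differentiable_one_div_Gamma (-(k : ℂ))).continuousAt.tendsto
      rw [Complex.Gamma_neg_nat_eq_zero, inv_zero] at h1
      exact h1.mono_left nhdsWithin_le_nhds
    have hlim : Tendsto Z (𝓝[≠] (-(k : ℂ)))
        (𝓝 ((-1) ^ k * (k.factorial : ℂ) * bernoulliSum ω y (n + k : ℤ))) := by
      have h1 := (hG0.mul (hg.continuousAt.tendsto.mono_left nhdsWithin_le_nhds)).add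
        (hG.mul (hh.continuousAt.tendsto.mono_left nhdsWithin_le_nhds))
      rw [hval, zero_mul, zero_add] at h1
      refine h1.congr' ?_
      filter_upwards [hev] with s hs
      rw [hs, sub_neg_eq_add]
      ring
    have hNF := hZ.1 (Set.mem_univ (-(k : ℂ)))
    have han : AnalyticAt ℂ Z (-(k : ℂ)) :=
      hNF.meromorphicOrderAt_nonneg_iff_analyticAt.1
        ((tendsto_nhds_iff_meromorphicOrderAt_nonneg hNF.meromorphicAt).1 ⟨_, hlim⟩)
    refine ⟨han, ?_⟩
    have hZval := tendsto_nhds_unique hlim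
      (han.continuousAt.tendsto.mono_left nhdsWithin_le_nhds)
    have hk : ((n : ℤ) + k - n) = k := by ring
    rw [hsum, ← hZval, hk, Int.toNat_natCast, zpow_add_one₀ (by norm_num), zpow_natCast]
    have hfac : (k.factorial : ℂ) ≠ 0 := Nat.cast_ne_zero.2 k.factorial_ne_zero
    have hsq : ((-1 : ℂ) ^ k) * (-1) ^ k = 1 := by rw [← mul_pow]; simp
    field_simp
    linear_combination bernoulliSum ω y (n + k : ℤ) * hsq
  · obtain ⟨g, h, hg, hh, hval, hev⟩ := hZl l
    obtain ⟨k, hk⟩ : ∃ k : ℕ, (n : ℤ) - l - 1 = k := ⟨((n : ℤ) - l - 1).toNat, by omega⟩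
    have hs₀ : (n : ℂ) - l = (k : ℂ) + 1 := by
      have : ((n - l - 1 : ℤ) : ℂ) = k := by rw [hk]; simp
      push_cast at this
      linear_combination this
    have hGa : AnalyticAt ℂ (fun s => (Gamma s)⁻¹) ((n : ℂ) - l) :=
      Complex.analyticAt_iff_eventually_differentiableAt.2
        (Eventually.of_forall fun z => Complex.differentiable_one_div_Gamma z)
    have hres := residueAt_eq_of_eventually (f := Z) (c := (n : ℂ) - l)
      (h := fun s => (Gamma s)⁻¹ * (g s * (s - (n - l)) + h s))
      (hGa.fun_mul ((hg.fun_mul (by fun_prop)).fun_add hh)) (by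
        filter_upwards [hev, self_mem_nhdsWithin] with s hs hne
        have hne : s - ((n : ℂ) - l) ≠ 0 := sub_ne_zero.2 hne
        rw [hs]
        field_simp)
    have hfac : (k.factorial : ℂ) ≠ 0 := Nat.cast_ne_zero.2 k.factorial_ne_zero
    have hG : Gamma ((n : ℂ) - l) = k.factorial := by
      rw [hs₀, Complex.Gamma_nat_eq_factorial]
    rw [hsum, hres, hval, hG, sub_self, mul_zero, zero_add, hk, Int.toNat_natCast]
    field_simp
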